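/- **Setting.** Let $t_0\in\mathbb R$, $I=[t_0,\infty)$, $X\subseteq\mathbb R^n$, $U\subseteq\mathbb R^m$ (Euclidean norms), and let $\mathcal M$ be a finite or infinite index set. Let $\sigma:I\to\mathcal M$ be a switching signal: there are $t_0<t_1<t_2<\cdots$ with $t_i\to\infty$ and $p_i\in\mathcal M$, $p_i\neq p_{i+1}$, with $\sigma=p_i$ on $[t_i,t_{i+1})$ for $i \ge 0$. Put $S=\{t_1,t_2,\dots\}$ and $I_p^\sigma=\{t\in I:\sigma(t)=p\}$. Consider the impulsive switched system $$\Sigma:\quad \dot x(t)=f_{\sigma(t)}(t,x(t),u(t))\ (t\in I\setminus S),\qquad x(t_i)=g_{\sigma(t_i^-)}(t_i,x(t_i^-),u(t_i^-))\ (t_i\in S),$$ where $f_p:I\times X\times U\to\mathbb R^n$ and $g_p:I\times X\times U\to X$ are Lipschitz in $x$ on bounded subsets of $X$, uniformly in $t\in I$, $p\in\mathcal M$ and in $u$ from bounded subsets of $U$. The set $U_c$ of inputs consists of the bounded measurable $u:I\to U$ whose left limits $u(t_i^-)\in U$ exist at all $t_i \in S$; $\|u\|_\infty=\sup_{t\in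 I}\|u(t)\|$. For an initial time $s\in I$ and state $x_0\in X$, a solution $x(\cdot)=x(\cdot\,;s,x_0,u,\sigma):[s,\infty)\to X$ is right continuous with $x(s)=x_0$, locally absolutely continuous on $[s,\infty)\setminus S$, has left limits in $X$ at all $t_i>s$, and satisfies the differential equation for almost every $t\ge s$ and the jump equation at every $t_i>s$. It is assumed that $\Sigma$ is robustly forward complete: for every $s\in I$, every $x_0 \in X$ and $u \in U_c$ there is a solution on $[s,\infty)$, and for all $C,D,\tau>0$ the norms $\|x(t;s,x_0,u,\sigma)\|$ with $\|x_0\|\le C$, $\|u\|_\infty\le D$, $t\in[s,s+\tau]$ are bounded. Class $\mathcal P$ consists of the continuous $\gamma:[0,\infty)\to[0,\infty)$ with $\gamma(0)=0$ and $\gamma(r)>0$ for $r>0$; $\mathcal K$ of the continuous strictly increasing $\gamma:[0,\infty)\to[0,\infty)$ with $\gamma(0)=0$; $\mathcal K_\infty$ of the unbounded members of $\mathcal K$; $\mathcal{KL}$ of the continuous $\beta:[0,\infty)^2\to[0,\infty)$ with $\beta(\cdot,r)\in\mathcal K$ for every $r\ge0$ and $\beta(s,\cdot)$ strictly decreasing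 to $0$ for every $s>0$. $\Sigma$ is *ISS* if there are $\beta\in\mathcal{KL}$, $\gamma\in\mathcal K_\infty$ such that for all initial conditions $(s,x_0)\in I\times X$ and all $u\in U_c$ there is a global solution with $$\|x(t;s,x_0,u,\sigma)\|\le\beta(\|x_0\|,t-s)+\gamma(\|u\|_\infty)\qquad\text{for all }t\ge s.$$ A *decreasing ISS-Lyapunov function* is a function $W:I\times X\to[0,\infty)$ of the form $W(t,x)=\widetilde V_{\sigma(t)}(t,x)$ with $\widetilde V_p$ continuous on $I_p^\sigma\times X$, such that on each $[t_i,t_{i+1})\times X$ the function $W$ extends continuously to $[t_i,t_{i+1}]\times X$ (the value at $(t_{i+1},x)$ being $W(t_{i+1}^-,x)$), and such that: 1. there are $\alpha_1,\alpha_2\in\mathcal K_\infty$ with $\alpha_1(\|x\|)\le W(t,x)\le\alpha_2(\|x\|)$ for all $t\in I$, $x\in X$; 2. there are $\chi\in\mathcal K_\infty$, $\underline\varphi,\overline\varphi\in\mathcal P$ and, for every $p\in\mathcal M$, functions $\psi_p\in\mathcal P$ with $\psi_p\le\mathrm{id}$ and $\varphi_p\in-\mathcal P$ with $\underline\varphi\le|\varphi_p|\le\overline\varphi$,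 such that for all $(s,x_0)\in I\times X$, all $u\in U_c$ and all solutions $x(t)=x(t;s,x_0,u,\sigma)$: $\tfrac{d}{dt}W(t,x(t))\le\varphi_{\sigma(t)}(W(t,x(t)))$ (upper right Dini derivative) for every $t\ge s$, $t\notin S$ with $W(t,x(t))\ge\chi(\|u\|_\infty)$; and $W(t_i,g_{\sigma(t_i^-)}(t_i,x(t_i^-),u(t_i^-)))\le\psi_{\sigma(t_i^-)}(W(t_i^-,x(t_i^-)))$ for every $t_i>s$ with $W(t_i^-,x(t_i^-))\ge\chi(\|u\|_\infty)$; 3. there is $\alpha_3\in\mathcal K$ such that, with the same $\chi$, $W(t_i,g_{\sigma(t_i^-)}(t_i,x,u(t_i^-)))\le\alpha_3(\|u\|_\infty)$ for all $x\in X$, $u\in U_c$, $i\ge1$ with $W(t_i^-,x)<\chi(\|u\|_\infty)$. **Theorem.** If $\Sigma$ (with the given switching signal $\sigma$) is ISS, then there exists a decreasing ISS-Lyapunov function $W=W_\sigma$ for $\Sigma$. -/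

import Mathlib

open Set Filter Topology MeasureTheory

noncomputable section

namespace ISS

/-! Comparison functions. They are represented by functions on `ℝ`, of which only the values on
`[0, ∞)` matter. -/

/-- Class `𝒫`: continuous positive definite functions `[0,∞) → [0,∞)`. -/
structure ClassP (γ : ℝ → ℝ) : Prop where
  continuousOn : ContinuousOn γ (Ici 0)
  map_zero : γ 0 = 0
  pos : ∀ r, 0 < r → 0 < γ r

/-- Class `𝒦`: continuous strictly increasing functions `[0,∞) → [0,∞)` vanishing at `0`. -/
structure ClassK (γ : ℝ → ℝ) : Prop where
  continuousOn : ContinuousOn γ (Ici 0)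
  strictMonoOn : StrictMonoOn γ (Ici 0)
  map_zero : γ 0 = 0

/-- Class `𝒦_∞`: unbounded functions of class `𝒦`. -/
structure ClassKInf (γ : ℝ → ℝ) : Prop extends ClassK γ where
  tendsto_atTop : Tendsto γ atTop atTop

/-- Class `𝒦ℒ`. -/
structure ClassKL (β : ℝ → ℝ → ℝ) : Prop where
  continuousOn : ContinuousOn (Function.uncurry β) (Ici 0 ×ˢ Ici 0)
  classK : ∀ r, 0 ≤ r → ClassK (fun s => β s r)
  strictAntiOn : ∀ s, 0 < s → StrictAntiOn (β s) (Ici 0)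
  tendsto_zero : ∀ s, 0 < s → Tendsto (β s) atTop (𝓝 0)

/-- The upper right Dini derivative of `v` at `t`, with values in `[-∞, ∞]`. -/
def upperDini (v : ℝ → ℝ) (t : ℝ) : EReal :=
  limsup (fun h : ℝ => (((v (t + h) - v t) / h : ℝ) : EReal)) (𝓝[>] 0)

/-- A switching signal on `I = [t₀, ∞)` with modes in `M`. `time 0` is the initial point `t₀` of
`I`, and `time 1 < time 2 < ⋯` are the switching instants; `mode i` is the value of the signal on
`[time i, time (i + 1))`. Consecutive modes differ, so the switching instants are exactly the
discontinuities, and they do not accumulate. -/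
structure SwitchingSignal (t₀ : ℝ) (M : Type*) where
  toFun : ℝ → M
  time : ℕ → ℝ
  mode : ℕ → M
  time_zero : time 0 = t₀
  time_strictMono : StrictMono time
  time_tendsto : Tendsto time atTop atTop
  toFun_eq : ∀ i, ∀ t ∈ Ico (time i) (time (i + 1)), toFun t = mode i
  mode_ne : ∀ i, mode i ≠ mode (i + 1)

/-- The set `S` of switching instants. -/
def SwitchingSignal.instants {t₀ : ℝ} {M : Type*} (σ : SwitchingSignal t₀ M) : Set ℝ :=
  range fun i : ℕ => σ.time (i + 1)

/-- The set `I_p` of times in `I` at which the mode `p` is active. -/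
def SwitchingSignal.activeSet {t₀ : ℝ} {M : Type*} (σ : SwitchingSignal t₀ M) (p : M) : Set ℝ :=
  {t | t₀ ≤ t ∧ σ.toFun t = p}

/-- The data of an impulsive switched system
`x' = f_{σ(t)}(t, x, u)` for `t ∈ I \ S`, `x(tᵢ⁺) = g_{σ(tᵢ⁻)}(tᵢ, x(tᵢ⁻), u(tᵢ⁻))` for `tᵢ ∈ S`,
on the time interval `I = [t₀, ∞)`, with state space `X ⊆ ℝⁿ`, input space `U ⊆ ℝᵐ` and a given
switching signal. Flow and jump maps are Lipschitz in the state on bounded sets of states,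
uniformly in time, in the mode and in bounded inputs. -/
structure ImpulsiveSwitchedSystem (n m : ℕ) (M : Type*) where
  t₀ : ℝ
  X : Set (EuclideanSpace ℝ (Fin n))
  U : Set (EuclideanSpace ℝ (Fin m))
  σ : SwitchingSignal t₀ M
  f : M → ℝ → EuclideanSpace ℝ (Fin n) → EuclideanSpace ℝ (Fin m) → EuclideanSpace ℝ (Fin n)
  g : M → ℝ → EuclideanSpace ℝ (Fin n) → EuclideanSpace ℝ (Fin m) → EuclideanSpace ℝ (Fin n)
  g_mem : ∀ p, ∀ t, t₀ ≤ t → ∀ x ∈ X, ∀ u ∈ U, g p t x u ∈ X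
  f_lipschitz : ∀ C D : ℝ, 0 < C → 0 < D → ∃ L : ℝ, ∀ p, ∀ t, t₀ ≤ t → ∀ u ∈ U, ‖u‖ ≤ D →
    ∀ x ∈ X, ∀ y ∈ X, ‖x‖ ≤ C → ‖y‖ ≤ C → ‖f p t x u - f p t y u‖ ≤ L * ‖x - y‖
  g_lipschitz : ∀ C D : ℝ, 0 < C → 0 < D → ∃ L : ℝ, ∀ p, ∀ t, t₀ ≤ t → ∀ u ∈ U, ‖u‖ ≤ D →
    ∀ x ∈ X, ∀ y ∈ X, ‖x‖ ≤ C → ‖y‖ ≤ C → ‖g p t x u - g p t y u‖ ≤ L * ‖x - y‖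

namespace ImpulsiveSwitchedSystem

variable {n m : ℕ} {M : Type*} (sys : ImpulsiveSwitchedSystem n m M)

/-- The space `U_c` of inputs: bounded measurable functions `I → U` whose left limits at the
switching instants exist in `U`. Values outside `I` are irrelevant. -/
structure IsInput (u : ℝ → EuclideanSpace ℝ (Fin m)) : Prop where
  mem : ∀ t, sys.t₀ ≤ t → u t ∈ sys.U
  measurable : AEMeasurable u (volume.restrict (Ici sys.t₀))
  bounded : ∃ D : ℝ, ∀ t, sys.t₀ ≤ t → ‖u t‖ ≤ D
  leftLim : ∀ i : ℕ, ∃ v ∈ sys.U, Tendsto u (𝓝[<] sys.σ.time (i + 1)) (𝓝 v)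

/-- The supremum norm of an input over `I`. -/
def inputNorm (u : ℝ → EuclideanSpace ℝ (Fin m)) : ℝ :=
  ⨆ t : Ici sys.t₀, ‖u t‖

/-- The state right after the jump at the switching instant `time (i + 1)`, if the state right
before it is `x` and the input is `u`. The active mode right before that instant is `mode i`. -/
def jump (i : ℕ) (u : ℝ → EuclideanSpace ℝ (Fin m)) (x : EuclideanSpace ℝ (Fin n)) :
    EuclideanSpace ℝ (Fin n) :=
  sys.g (sys.σ.mode i) (sys.σ.time (i + 1)) x (Function.leftLim u (sys.σ.time (i + 1)))

/-- `x` is a (global) solution on `[s, ∞)` for the input `u` with `x(s) = x₀`. Solutions are right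
continuous, so `x(tᵢ) = x(tᵢ⁺)`. -/
structure IsSolution (u : ℝ → EuclideanSpace ℝ (Fin m)) (s : ℝ) (x₀ : EuclideanSpace ℝ (Fin n))
    (x : ℝ → EuclideanSpace ℝ (Fin n)) : Prop where
  init : x s = x₀
  mem : ∀ t, s ≤ t → x t ∈ sys.X
  rightCont : ∀ t, s ≤ t → ContinuousWithinAt x (Ici t) t
  /-- `x` is locally absolutely continuous off the switching instants. -/
  absCont : ∀ a b, s ≤ a → a ≤ b → Disjoint (Icc a b) sys.σ.instants →
    AbsolutelyContinuousOnInterval x a b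
  flow : ∀ᵐ t, s ≤ t → HasDerivAt x (sys.f (sys.σ.toFun t) t (x t) (u t)) t
  leftLim : ∀ i : ℕ, s < sys.σ.time (i + 1) →
    ∃ y ∈ sys.X, Tendsto x (𝓝[<] sys.σ.time (i + 1)) (𝓝 y)
  jump : ∀ i : ℕ, s < sys.σ.time (i + 1) →
    x (sys.σ.time (i + 1)) = sys.jump i u (Function.leftLim x (sys.σ.time (i + 1)))

/-- Robust forward completeness: from all initial conditions `(s, x₀) ∈ I × X` and for all inputs
there is a global solution, and for bounded initial states and bounded inputs the solutions are
bounded on compact time intervals. -/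
def IsRobustlyForwardComplete : Prop :=
  ∀ s, sys.t₀ ≤ s →
    (∀ x₀ ∈ sys.X, ∀ u, sys.IsInput u → ∃ x, sys.IsSolution u s x₀ x) ∧
    ∀ C D τ : ℝ, 0 < C → 0 < D → 0 < τ → ∃ K : ℝ,
      ∀ x₀ ∈ sys.X, ‖x₀‖ ≤ C → ∀ u, sys.IsInput u → sys.inputNorm u ≤ D →
        ∀ x, sys.IsSolution u s x₀ x → ∀ t ∈ Icc s (s + τ), ‖x t‖ ≤ K

/-- Input-to-state stability, for all initial conditions `(s, x₀) ∈ I × X`. -/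
def IsISS : Prop :=
  ∃ (β : ℝ → ℝ → ℝ) (γ : ℝ → ℝ), ClassKL β ∧ ClassKInf γ ∧
    ∀ s, sys.t₀ ≤ s → ∀ x₀ ∈ sys.X, ∀ u, sys.IsInput u →
      ∃ x, sys.IsSolution u s x₀ x ∧
        ∀ t, s ≤ t → ‖x t‖ ≤ β ‖x₀‖ (t - s) + γ (sys.inputNorm u)

/-- The left limit `V(tᵢ⁻, x)` at the switching instant `tᵢ = time (i + 1)`. -/
def leftVal (V : ℝ → EuclideanSpace ℝ (Fin n) → ℝ) (i : ℕ) (x : EuclideanSpace ℝ (Fin n)) : ℝ :=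
  Function.leftLim (fun t => V t x) (sys.σ.time (i + 1))

/-- `V` is of the form `V(t, x) = Ṽ_{σ(t)}(t, x)` with `Ṽ_p` nonnegative and continuous on
`I_p × X`, and it is piecewise continuous on `I × X`: on each piece `[tᵢ, tᵢ₊₁) × X` it extends
continuously to `[tᵢ, tᵢ₊₁] × X`. (In particular it is locally bounded on `I × X`.) -/
structure IsSwitchedPiecewiseContinuous (V : ℝ → EuclideanSpace ℝ (Fin n) → ℝ) : Prop where
  nonneg : ∀ t, sys.t₀ ≤ t → ∀ x ∈ sys.X, 0 ≤ V t x
  modes : ∃ V' : M → ℝ → EuclideanSpace ℝ (Fin n) → ℝ,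
    (∀ p, ContinuousOn (Function.uncurry (V' p)) (sys.σ.activeSet p ×ˢ sys.X)) ∧
    ∀ t, sys.t₀ ≤ t → ∀ x ∈ sys.X, V t x = V' (sys.σ.toFun t) t x
  leftLim : ∀ i : ℕ, ∀ x ∈ sys.X, ∃ l : ℝ, Tendsto (Function.uncurry V)
    (𝓝[Ico (sys.σ.time i) (sys.σ.time (i + 1)) ×ˢ sys.X] (sys.σ.time (i + 1), x)) (𝓝 l)

/-- `V` is a candidate ISS-Lyapunov function (in implication form) with the flow rates `φ p` and
the jump rates `ψ p`. -/
def IsCandidateISSLyapunovWith (V : ℝ → EuclideanSpace ℝ (Fin n) → ℝ) (φ ψ : M → ℝ → ℝ) : Prop :=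
  sys.IsSwitchedPiecewiseContinuous V ∧
  (∃ α₁ α₂ : ℝ → ℝ, ClassKInf α₁ ∧ ClassKInf α₂ ∧
    ∀ t, sys.t₀ ≤ t → ∀ x ∈ sys.X, α₁ ‖x‖ ≤ V t x ∧ V t x ≤ α₂ ‖x‖) ∧
  (∀ p, ClassP (ψ p)) ∧
  (∀ p, ClassP (φ p) ∨ ClassP (fun s => -φ p s)) ∧
  (∃ φlow φup : ℝ → ℝ, ClassP φlow ∧ ClassP φup ∧
    ∀ p, ∀ s, 0 ≤ s → φlow s ≤ |φ p s| ∧ |φ p s| ≤ φup s) ∧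
  ∃ χ : ℝ → ℝ, ClassKInf χ ∧
    (∀ s, sys.t₀ ≤ s → ∀ x₀ ∈ sys.X, ∀ u, sys.IsInput u → ∀ x, sys.IsSolution u s x₀ x →
      (∀ t, s ≤ t → t ∉ sys.σ.instants → χ (sys.inputNorm u) ≤ V t (x t) →
        upperDini (fun r => V r (x r)) t ≤ ((φ (sys.σ.toFun t) (V t (x t)) : ℝ) : EReal)) ∧
      (∀ i : ℕ, s < sys.σ.time (i + 1) →
        χ (sys.inputNorm u) ≤ sys.leftVal V i (Function.leftLim x (sys.σ.time (i + 1))) →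
        V (sys.σ.time (i + 1)) (sys.jump i u (Function.leftLim x (sys.σ.time (i + 1)))) ≤
          ψ (sys.σ.mode i) (sys.leftVal V i (Function.leftLim x (sys.σ.time (i + 1)))))) ∧
    ∃ α₃ : ℝ → ℝ, ClassK α₃ ∧ ∀ x ∈ sys.X, ∀ u, sys.IsInput u → ∀ i : ℕ,
      sys.leftVal V i x < χ (sys.inputNorm u) →
      V (sys.σ.time (i + 1)) (sys.jump i u x) ≤ α₃ (sys.inputNorm u)

/-- `W` is a decreasing ISS-Lyapunov function: a candidate ISS-Lyapunov function all of whose flow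
rates lie in `-𝒫` and all of whose jump rates are at most the identity. -/
def IsDecreasingISSLyapunov (W : ℝ → EuclideanSpace ℝ (Fin n) → ℝ) : Prop :=
  ∃ φ ψ : M → ℝ → ℝ, sys.IsCandidateISSLyapunovWith W φ ψ ∧
    ∀ p, ClassP (fun s => -φ p s) ∧ ∀ s, 0 ≤ s → ψ p s ≤ s

end ImpulsiveSwitchedSystem

end ISS

end

noncomputable section

/-! The Lyapunov function is explicit. `W(t, x)` is the supremum of `‖x‖` and of all payoffs `weight
τ * gate ‖z (t + τ)‖ (2 * γ ‖u‖∞)` over inputs `u`, solutions `z` from `(t, x)` and elapsed times `τ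
≥ 0`. The gate ignores states that the gain alone can explain, so by ISS a payoff is at most `4 * β
‖x‖ τ` and `W` is finite. The separate term `‖x‖` gives the lower bound even if every admissible
input is large.

Decay: a payoff seen from a later point of a solution is also available from an earlier one, by
concatenating inputs, but with a larger elapsed time and hence a larger weight. The gain in weight
is bounded below because only a bounded range of `τ` can produce a payoff comparable with `W`
(`ClassKL.exists_rate`, `lyapunov_add_le`). The same argument across a jump shows that `W` does not
increase there, so the identity serves as jump rate.

Continuity is the delicate point: the flow maps are not assumed bounded in time or regular in it, so
it is not clear that solutions for different inputs move little in a short time. This follows from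
completeness and ISS. If some direction admitted, arbitrarily close to an instant, inputs pushing
the state a fixed amount further than a reference solution, such inputs could be concatenated on
disjoint intervals. By the Lipschitz condition each push barely depends on the state, so the pushes
add up to an unbounded displacement of a bounded solution (`exists_smallDisplacement_left`,
`exists_smallDisplacement_right`). Small displacements also carry the ISS estimate over to the jump
maps at arbitrary states (`norm_jump_le`). -/

/-! ### Mean value inequalities for absolutely continuous curves. -/

theorem AbsolutelyContinuousOnInterval.inner_const {E : Type*} [NormedAddCommGroup E]
    [InnerProductSpace ℝ E] {h : ℝ → E} {a b : ℝ} (hh : AbsolutelyContinuousOnInterval h a b)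
    (v : E) : AbsolutelyContinuousOnInterval (fun t => inner ℝ v (h t)) a b := by
  unfold AbsolutelyContinuousOnInterval at *
  have h1 := hh.const_mul ‖v‖
  rw [mul_zero] at h1
  refine squeeze_zero (fun E => Finset.sum_nonneg fun _ _ => dist_nonneg) (fun E => ?_) h1
  rw [Finset.mul_sum]
  refine Finset.sum_le_sum fun i _ => ?_
  rw [dist_eq_norm, dist_eq_norm, ← inner_sub_right]
  exact norm_inner_le_norm _ _

theorem AbsolutelyContinuousOnInterval.congr {E : Type*} [PseudoMetricSpace E] {f g : ℝ → E}
    {a b : ℝ} (hf : AbsolutelyContinuousOnInterval f a b) (h : EqOn f g (uIcc a b)) :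
    AbsolutelyContinuousOnInterval g a b := by
  unfold AbsolutelyContinuousOnInterval at *
  refine hf.congr' ?_
  have : AbsolutelyContinuousOnInterval.disjWithin a b ∈
      AbsolutelyContinuousOnInterval.totalLengthFilter ⊓
        𝓟 (AbsolutelyContinuousOnInterval.disjWithin a b) :=
    mem_inf_of_right (mem_principal_self _)
  filter_upwards [this] with E hE
  refine Finset.sum_congr rfl fun i hi => ?_
  rw [h (hE.1 i hi).1, h (hE.1 i hi).2]

/-- Pairing with the total displacement `v` reduces the claim to the fundamental theorem of calculus
for a real function; one factor `‖v‖` then cancels. -/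
theorem AbsolutelyContinuousOnInterval.norm_sub_le {E : Type*} [NormedAddCommGroup E]
    [InnerProductSpace ℝ E] {h : ℝ → E} {a b C : ℝ} (hab : a ≤ b)
    (hh : AbsolutelyContinuousOnInterval h a b)
    (hd : ∀ᵐ t, t ∈ Ioo a b → ∃ h', HasDerivAt h h' t ∧ ‖h'‖ ≤ C) :
    ‖h b - h a‖ ≤ C * (b - a) := by
  set v := h b - h a with hv
  have hg := hh.inner_const v
  have h1 := hg.integral_deriv_eq_sub
  have h2 : ∀ᵐ t, t ∈ Set.uIoc a b → ‖deriv (fun t => inner ℝ v (h t)) t‖ ≤ ‖v‖ * C := by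
    have hb : ∀ᵐ t : ℝ, t ≠ b := by simp [ae_iff, measure_singleton]
    filter_upwards [hd, hb] with t ht htb hmem
    rw [uIoc_of_le hab] at hmem
    obtain ⟨h', hder, hC⟩ := ht ⟨hmem.1, lt_of_le_of_ne hmem.2 htb⟩
    have h3 : HasDerivAt (fun t => inner ℝ v (h t)) (inner ℝ v h') t :=
      ((innerSL ℝ v).hasFDerivAt.comp_hasDerivAt t hder)
    rw [h3.deriv]
    exact (norm_inner_le_norm _ _).trans (by gcongr)
  have h3 := intervalIntegral.norm_integral_le_of_norm_le_const_ae h2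
  rw [h1, ← inner_sub_right, ← hv, real_inner_self_eq_norm_sq, abs_of_nonneg (sub_nonneg.2 hab),
    Real.norm_eq_abs, abs_of_nonneg (by positivity)] at h3
  rcases (norm_nonneg v).eq_or_lt with h0 | h0
  -- For `v = 0` nothing can be cancelled and `0 ≤ C * (b - a)` is needed. If it failed, `C` would
  -- be negative, no derivative could satisfy the bound, and `Ioo a b` would be null.
  · rw [← h0]
    by_contra hneg
    push Not at hneg
    have hlt : a < b := by
      rcases hab.eq_or_lt with h | h
      · simp [h] at hneg
      · exact h
    have hC : C < 0 := by
      by_contra hC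
      push Not at hC
      nlinarith
    have : ∀ᵐ t, t ∉ Ioo a b := by
      filter_upwards [hd] with t ht hmem
      obtain ⟨h', -, h4⟩ := ht hmem
      exact absurd h4 (by have := norm_nonneg h'; linarith)
    have h5 : volume (Ioo a b) = 0 := by
      rw [measure_eq_zero_iff_ae_notMem]; exact this
    rw [Real.volume_Ioo] at h5
    simp at h5
    linarith
  · have : ‖v‖ * ‖v‖ ≤ ‖v‖ * (C * (b - a)) := by nlinarith
    exact le_of_mul_le_mul_left this h0

/-- Solutions are absolutely continuous only off the switching instants, so the endpoints are
reached by continuity. -/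
theorem norm_sub_le_of_absolutelyContinuous_interior {E : Type*} [NormedAddCommGroup E]
    [InnerProductSpace ℝ E] {h : ℝ → E} {a b C : ℝ} (hab : a ≤ b)
    (hc : ContinuousOn h (Icc a b))
    (hh : ∀ c d, a < c → c ≤ d → d < b → AbsolutelyContinuousOnInterval h c d)
    (hd : ∀ᵐ t, t ∈ Ioo a b → ∃ h', HasDerivAt h h' t ∧ ‖h'‖ ≤ C) :
    ‖h b - h a‖ ≤ C * (b - a) := by
  rcases hab.eq_or_lt with rfl | hlt
  · simp
  have hev : ∀ᶠ η : ℝ in 𝓝[>] 0, 0 < η ∧ η < (b - a) / 2 :=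
    Filter.Eventually.and self_mem_nhdsWithin
      (mem_nhdsWithin_of_mem_nhds (Iio_mem_nhds (by linarith)))
  have t1 : Tendsto (fun η : ℝ => h (b - η)) (𝓝[>] 0) (𝓝 (h b)) := by
    refine (hc b (right_mem_Icc.2 hab)).tendsto.comp (tendsto_nhdsWithin_iff.2 ⟨?_, ?_⟩)
    · exact ((show Continuous fun η : ℝ => b - η by fun_prop).tendsto' 0 b (by simp)).mono_left
        nhdsWithin_le_nhds
    · filter_upwards [hev] with η hη
      constructor <;> linarith [hη.1, hη.2]
  have t2 : Tendsto (fun η : ℝ => h (a + η)) (𝓝[>] 0) (𝓝 (h a)) := by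
    refine (hc a (left_mem_Icc.2 hab)).tendsto.comp (tendsto_nhdsWithin_iff.2 ⟨?_, ?_⟩)
    · exact ((show Continuous fun η : ℝ => a + η by fun_prop).tendsto' 0 a (by simp)).mono_left
        nhdsWithin_le_nhds
    · filter_upwards [hev] with η hη
      constructor <;> linarith [hη.1, hη.2]
  have t3 : Tendsto (fun η : ℝ => C * ((b - η) - (a + η))) (𝓝[>] 0) (𝓝 (C * (b - a))) := by
    exact ((show Continuous fun η : ℝ => C * ((b - η) - (a + η)) by fun_prop).tendsto' 0 _
      (by simp)).mono_left nhdsWithin_le_nhds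
  refine le_of_tendsto_of_tendsto (t1.sub t2).norm t3 ?_
  filter_upwards [hev] with η hη
  refine (hh _ _ (by linarith [hη.1]) (by linarith [hη.2]) (by linarith [hη.1])).norm_sub_le
    (by linarith [hη.2]) ?_
  filter_upwards [hd] with t ht hmem
  exact ht ⟨by linarith [hmem.1, hη.1], by linarith [hmem.2, hη.1]⟩

/-! ### Flows between switching instants and Grönwall's inequality. -/

namespace ISS
namespace ImpulsiveSwitchedSystem

variable {n m : ℕ} {M : Type*} (sys : ImpulsiveSwitchedSystem n m M)

/-- `L ≥ 0` is a Lipschitz constant of the flow maps on states of norm at most `K`, for inputs of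
norm at most `D`. -/
def FlowLipschitz (K D L : ℝ) : Prop :=
  0 ≤ L ∧ ∀ p, ∀ t, sys.t₀ ≤ t → ∀ u ∈ sys.U, ‖u‖ ≤ D →
    ∀ x ∈ sys.X, ∀ y ∈ sys.X, ‖x‖ ≤ K → ‖y‖ ≤ K → ‖sys.f p t x u - sys.f p t y u‖ ≤ L * ‖x - y‖

/-- `L ≥ 0` is a Lipschitz constant of the jump maps on states of norm at most `K`, for inputs of
norm at most `D`. -/
def JumpLipschitz (K D L : ℝ) : Prop :=
  0 ≤ L ∧ ∀ p, ∀ t, sys.t₀ ≤ t → ∀ u ∈ sys.U, ‖u‖ ≤ D →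
    ∀ x ∈ sys.X, ∀ y ∈ sys.X, ‖x‖ ≤ K → ‖y‖ ≤ K → ‖sys.g p t x u - sys.g p t y u‖ ≤ L * ‖x - y‖

theorem exists_flowLipschitz (K D : ℝ) : ∃ L, sys.FlowLipschitz K D L := by
  obtain ⟨L, hL⟩ := sys.f_lipschitz (max K 1) (max D 1) (by positivity) (by positivity)
  refine ⟨max L 0, le_max_right _ _, fun p t ht u hu huD x hx y hy hxK hyK => ?_⟩
  exact (hL p t ht u hu (huD.trans (le_max_left _ _)) x hx y hy (hxK.trans (le_max_left _ _))
    (hyK.trans (le_max_left _ _))).trans (by gcongr; exact le_max_left _ _)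

theorem exists_jumpLipschitz (K D : ℝ) : ∃ L, sys.JumpLipschitz K D L := by
  obtain ⟨L, hL⟩ := sys.g_lipschitz (max K 1) (max D 1) (by positivity) (by positivity)
  refine ⟨max L 0, le_max_right _ _, fun p t ht u hu huD x hx y hy hxK hyK => ?_⟩
  exact (hL p t ht u hu (huD.trans (le_max_left _ _)) x hx y hy (hxK.trans (le_max_left _ _))
    (hyK.trans (le_max_left _ _))).trans (by gcongr; exact le_max_left _ _)

/-- `z` follows the flow of the system on `[a, b]` with input `u`. -/
structure IsFlow (u : ℝ → EuclideanSpace ℝ (Fin m)) (a b : ℝ)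
    (z : ℝ → EuclideanSpace ℝ (Fin n)) : Prop where
  cont : ContinuousOn z (Icc a b)
  mem : ∀ t ∈ Icc a b, z t ∈ sys.X
  absCont : ∀ c d, a < c → c ≤ d → d < b → AbsolutelyContinuousOnInterval z c d
  deriv : ∀ᵐ t, t ∈ Ioo a b → HasDerivAt z (sys.f (sys.σ.toFun t) t (z t) (u t)) t

variable {sys} {u u' : ℝ → EuclideanSpace ℝ (Fin m)} {z w : ℝ → EuclideanSpace ℝ (Fin n)}
  {a b c d K D L : ℝ}

theorem IsFlow.mono (hz : sys.IsFlow u a b z) (hac : a ≤ c) (hdb : d ≤ b) :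
    sys.IsFlow u c d z where
  cont := hz.cont.mono (Icc_subset_Icc hac hdb)
  mem t ht := hz.mem t (Icc_subset_Icc hac hdb ht)
  absCont e f h1 h2 h3 := hz.absCont e f (hac.trans_lt h1) h2 (h3.trans_le hdb)
  deriv := by
    filter_upwards [hz.deriv] with t ht hmem using ht (Ioo_subset_Ioo hac hdb hmem)

theorem IsFlow.congr_input (hz : sys.IsFlow u a b z) (h : ∀ t ∈ Ioo a b, u t = u' t) :
    sys.IsFlow u' a b z where
  cont := hz.cont
  mem := hz.mem
  absCont := hz.absCont
  deriv := by
    filter_upwards [hz.deriv] with t ht hmem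
    rw [← h t hmem]
    exact ht hmem

/-- The displacements of two flows with the same input differ by at most the Lipschitz constant
times the distance of the flows times the duration. -/
theorem IsFlow.norm_displacement_sub_le (hL : sys.FlowLipschitz K D L) (hz : sys.IsFlow u a b z)
    (hw : sys.IsFlow u a b w) (ha : sys.t₀ ≤ a) (hab : a ≤ b)
    (hu : ∀ t ∈ Ioo a b, u t ∈ sys.U ∧ ‖u t‖ ≤ D) (hzK : ∀ t ∈ Icc a b, ‖z t‖ ≤ K)
    (hwK : ∀ t ∈ Icc a b, ‖w t‖ ≤ K) {R : ℝ} (hR : ∀ t ∈ Icc a b, ‖z t - w t‖ ≤ R) :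
    ‖(z b - w b) - (z a - w a)‖ ≤ L * R * (b - a) := by
  refine norm_sub_le_of_absolutelyContinuous_interior (h := fun t => z t - w t) hab
    (hz.cont.sub hw.cont) (fun e f h1 h2 h3 => (hz.absCont e f h1 h2 h3).sub
      (hw.absCont e f h1 h2 h3)) ?_
  filter_upwards [hz.deriv, hw.deriv] with t h1 h2 hmem
  have hmem' := Ioo_subset_Icc_self hmem
  refine ⟨_, (h1 hmem).sub (h2 hmem), ?_⟩
  refine (hL.2 _ _ (ha.trans hmem.1.le) _ (hu t hmem).1 (hu t hmem).2 _ (hz.mem t hmem') _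
    (hw.mem t hmem') (hzK t hmem') (hwK t hmem')).trans ?_
  exact mul_le_mul_of_nonneg_left (hR t hmem') hL.1

/-- Under a common input the displacement is independent of the state up to an error linear in the
duration. The chains of inputs below rest on this. -/
theorem IsFlow.norm_displacement_sub_le' (hL : sys.FlowLipschitz K D L) (hz : sys.IsFlow u a b z)
    (hw : sys.IsFlow u a b w) (ha : sys.t₀ ≤ a) (hab : a ≤ b)
    (hu : ∀ t ∈ Ioo a b, u t ∈ sys.U ∧ ‖u t‖ ≤ D) (hzK : ∀ t ∈ Icc a b, ‖z t‖ ≤ K)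
    (hwK : ∀ t ∈ Icc a b, ‖w t‖ ≤ K) :
    ‖(z b - z a) - (w b - w a)‖ ≤ L * (2 * K) * (b - a) := by
  rw [sub_sub_sub_comm]
  exact hz.norm_displacement_sub_le hL hw ha hab hu hzK hwK fun t ht =>
    (norm_sub_le _ _).trans (by linarith [hzK t ht, hwK t ht])

/-- Grönwall's inequality for two flows with the same input. -/
theorem IsFlow.norm_sub_le_exp (hL : sys.FlowLipschitz K D L) (hz : sys.IsFlow u a b z)
    (hw : sys.IsFlow u a b w) (ha : sys.t₀ ≤ a)
    (hu : ∀ t ∈ Ioo a b, u t ∈ sys.U ∧ ‖u t‖ ≤ D) (hzK : ∀ t ∈ Icc a b, ‖z t‖ ≤ K)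
    (hwK : ∀ t ∈ Icc a b, ‖w t‖ ≤ K) :
    ∀ t ∈ Icc a b, ‖z t - w t‖ ≤ ‖z a - w a‖ * Real.exp (L * (t - a)) := by
  intro t ht
  have hcont : ContinuousOn (fun t => ‖z t - w t‖) (Icc a b) := (hz.cont.sub hw.cont).norm
  have key := le_gronwallBound_of_liminf_deriv_right_le (f := fun t => ‖z t - w t‖)
    (f' := fun t => L * ‖z t - w t‖) (δ := ‖z a - w a‖) (K := L) (ε := 0) hcont ?_ le_rfl
    (fun x _ => by simp) t ht
  · rwa [gronwallBound_ε0] at key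
  intro x hx r hr
  -- The distance may fail to be differentiable, so only its right difference quotients are bounded:
  -- the slack in `r` allows a bound `R` that holds on a short interval to the right of `x`.
  obtain ⟨R, hxR, hRr⟩ : ∃ R, ‖z x - w x‖ < R ∧ L * R < r := by
    have : ∀ᶠ R in 𝓝[>] ‖z x - w x‖, L * R < r := by
      have h1 : Tendsto (fun R => L * R) (𝓝[>] ‖z x - w x‖) (𝓝 (L * ‖z x - w x‖)) :=
        (tendsto_id.mono_left nhdsWithin_le_nhds).const_mul L
      exact h1.eventually (Iio_mem_nhds hr)
    obtain ⟨R, hR, hR'⟩ := (this.and self_mem_nhdsWithin).exists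
    exact ⟨R, hR', hR⟩
  have hnear : ∀ᶠ y in 𝓝[Icc a b] x, ‖z y - w y‖ < R :=
    (hcont x (Ico_subset_Icc_self hx)).eventually (Iio_mem_nhds hxR)
  have hnear2 : ∃ δ > 0, ∀ y ∈ Ico x (x + δ), y ≤ b → ‖z y - w y‖ < R := by
    obtain ⟨δ, hδ, hsub⟩ := Metric.mem_nhdsWithin_iff.1 hnear
    refine ⟨δ, hδ, fun y hy hyb => hsub ⟨?_, hx.1.trans hy.1, hyb⟩⟩
    rw [Metric.mem_ball, Real.dist_eq, abs_lt]
    constructor <;> linarith [hy.1, hy.2]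
  obtain ⟨δ, hδ, hδR⟩ := hnear2
  refine Filter.Eventually.frequently ?_
  have : ∀ᶠ y in 𝓝[>] x, x < y ∧ y < x + δ ∧ y < b :=
    Filter.Eventually.and self_mem_nhdsWithin (mem_nhdsWithin_of_mem_nhds
      (Filter.Eventually.and (Iio_mem_nhds (by linarith)) (Iio_mem_nhds hx.2)))
  filter_upwards [this] with y ⟨hxy, hyδ, hyb⟩
  have h1 := (hz.mono hx.1 hyb.le).norm_displacement_sub_le hL (hw.mono hx.1 hyb.le)
    (ha.trans hx.1) hxy.le (fun t ht => hu t (Ioo_subset_Ioo hx.1 hyb.le ht))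
    (fun t ht => hzK t (Icc_subset_Icc hx.1 hyb.le ht))
    (fun t ht => hwK t (Icc_subset_Icc hx.1 hyb.le ht)) (R := R)
    (fun t ht => (hδR t ⟨ht.1, by linarith [ht.2]⟩ (ht.2.trans hyb.le)).le)
  have h2 : ‖z y - w y‖ - ‖z x - w x‖ ≤ L * R * (y - x) := (norm_sub_norm_le _ _).trans h1
  refine lt_of_le_of_lt ?_ hRr
  rw [inv_mul_le_iff₀ (by linarith)]
  linarith

end ImpulsiveSwitchedSystem

/-! ### Switching instants, inputs, and restrictions of solutions. -/

/-- Existence of the limit matters: without one, `Function.leftLim` defaults to the value at `a`,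
where `f` and `g` may differ. -/
theorem leftLim_congr {E : Type*} [TopologicalSpace E] [T2Space E] {f g : ℝ → E} {a b : ℝ} {y : E}
    (hba : b < a) (hf : Tendsto f (𝓝[<] a) (𝓝 y)) (h : ∀ t ∈ Ico b a, f t = g t) :
    Function.leftLim f a = Function.leftLim g a := by
  have hg : Tendsto g (𝓝[<] a) (𝓝 y) := by
    refine hf.congr' ?_
    filter_upwards [Ico_mem_nhdsLT hba] with t ht using h t ht
  rw [leftLim_eq_of_tendsto hf, leftLim_eq_of_tendsto hg]

namespace SwitchingSignal

variable {t₀ : ℝ} {M : Type*} (σ : SwitchingSignal t₀ M)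

theorem t₀_le_time (i : ℕ) : t₀ ≤ σ.time i :=
  σ.time_zero.symm.trans_le (σ.time_strictMono.monotone (Nat.zero_le i))

theorem time_lt_succ (i : ℕ) : σ.time i < σ.time (i + 1) := σ.time_strictMono (Nat.lt_succ_self i)

theorem exists_le_time (t : ℝ) : ∃ j, t ≤ σ.time j :=
  (σ.time_tendsto.eventually_ge_atTop t).exists

theorem exists_mem_Ico {t : ℝ} (ht : t₀ ≤ t) : ∃ i, t ∈ Ico (σ.time i) (σ.time (i + 1)) := by
  classical
  have hex : ∃ k, t < σ.time k := (σ.time_tendsto.eventually_gt_atTop t).exists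
  have hpos : Nat.find hex ≠ 0 := by
    intro h0
    have := Nat.find_spec hex
    rw [h0, σ.time_zero] at this
    linarith
  obtain ⟨k, hk⟩ := Nat.exists_eq_succ_of_ne_zero hpos
  refine ⟨k, ?_, by have := Nat.find_spec hex; rwa [hk] at this⟩
  by_contra hlt
  push Not at hlt
  have := Nat.find_min' hex hlt
  omega

theorem disjoint_instants {i : ℕ} {a b : ℝ} (ha : σ.time i < a) (hb : b < σ.time (i + 1)) :
    Disjoint (Icc a b) σ.instants := by
  rw [Set.disjoint_left]
  rintro t ht ⟨k, rfl⟩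
  have h1 := σ.time_strictMono.lt_iff_lt.1 (ha.trans_le ht.1)
  have h2 := σ.time_strictMono.lt_iff_lt.1 (ht.2.trans_lt hb)
  omega

end SwitchingSignal

namespace ImpulsiveSwitchedSystem

variable {n m : ℕ} {M : Type*} {sys : ImpulsiveSwitchedSystem n m M}
  {u v : ℝ → EuclideanSpace ℝ (Fin m)}

theorem inputNorm_nonneg (u : ℝ → EuclideanSpace ℝ (Fin m)) : 0 ≤ sys.inputNorm u :=
  Real.iSup_nonneg fun _ => norm_nonneg _

theorem inputNorm_le {D : ℝ} (h : ∀ t, sys.t₀ ≤ t → ‖u t‖ ≤ D) : sys.inputNorm u ≤ D :=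
  have : Nonempty (Ici sys.t₀) := ⟨⟨sys.t₀, mem_Ici.2 le_rfl⟩⟩
  ciSup_le fun t => h t t.2

theorem IsInput.norm_le (hu : sys.IsInput u) {t : ℝ} (ht : sys.t₀ ≤ t) :
    ‖u t‖ ≤ sys.inputNorm u := by
  obtain ⟨D, hD⟩ := hu.bounded
  exact le_ciSup (f := fun t : Ici sys.t₀ => ‖u t‖)
    ⟨D, by rintro _ ⟨t, rfl⟩; exact hD t t.2⟩ ⟨t, ht⟩

theorem IsInput.tendsto_leftLim (hu : sys.IsInput u) (i : ℕ) :
    Tendsto u (𝓝[<] sys.σ.time (i + 1)) (𝓝 (Function.leftLim u (sys.σ.time (i + 1)))) := by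
  obtain ⟨v, -, hv⟩ := hu.leftLim i
  exact tendsto_leftLim_of_tendsto ⟨v, hv⟩

theorem IsInput.leftLim_mem (hu : sys.IsInput u) (i : ℕ) :
    Function.leftLim u (sys.σ.time (i + 1)) ∈ sys.U := by
  obtain ⟨v, hvU, hv⟩ := hu.leftLim i
  rwa [leftLim_eq_of_tendsto hv]

theorem IsInput.norm_leftLim_le (hu : sys.IsInput u) (i : ℕ) :
    ‖Function.leftLim u (sys.σ.time (i + 1))‖ ≤ sys.inputNorm u := by
  refine le_of_tendsto (hu.tendsto_leftLim i).norm ?_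
  filter_upwards [Ico_mem_nhdsLT (sys.σ.time_lt_succ i)] with t ht
  exact hu.norm_le ((sys.σ.t₀_le_time i).trans ht.1)

/-- The input equal to `u` before time `r` and to `v` from `r` on. -/
def concat (u v : ℝ → EuclideanSpace ℝ (Fin m)) (r : ℝ) : ℝ → EuclideanSpace ℝ (Fin m) :=
  fun t => if t < r then u t else v t

theorem concat_of_lt {r t : ℝ} (h : t < r) : concat u v r t = u t := if_pos h

theorem concat_of_le {r t : ℝ} (h : r ≤ t) : concat u v r t = v t := if_neg (not_lt.2 h)

theorem IsInput.concat (hu : sys.IsInput u) (hv : sys.IsInput v) (r : ℝ) :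
    sys.IsInput (concat u v r) where
  mem t ht := by
    rcases lt_or_ge t r with h | h
    · rw [concat_of_lt h]; exact hu.mem t ht
    · rw [concat_of_le h]; exact hv.mem t ht
  measurable := by
    have h1 := hu.measurable.indicator (measurableSet_Iio (a := r))
    have h2 := hv.measurable.indicator (measurableSet_Ici (a := r))
    refine (h1.add h2).congr (Eventually.of_forall fun t => ?_)
    rcases lt_or_ge t r with h | h
    · simp [concat_of_lt h, h]
    · simp [concat_of_le h, h]
  bounded := by
    refine ⟨max (sys.inputNorm u) (sys.inputNorm v), fun t ht => ?_⟩
    rcases lt_or_ge t r with h | h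
    · rw [concat_of_lt h]; exact (hu.norm_le ht).trans (le_max_left _ _)
    · rw [concat_of_le h]; exact (hv.norm_le ht).trans (le_max_right _ _)
  leftLim i := by
    -- A switching instant equal to `r` belongs to the first case: its left limit sees only `u`.
    rcases le_or_gt (sys.σ.time (i + 1)) r with h | h
    · obtain ⟨y, hy, hlim⟩ := hu.leftLim i
      refine ⟨y, hy, hlim.congr' ?_⟩
      filter_upwards [self_mem_nhdsWithin] with t ht
      rw [concat_of_lt (lt_of_lt_of_le ht h)]
    · obtain ⟨y, hy, hlim⟩ := hv.leftLim i
      refine ⟨y, hy, hlim.congr' ?_⟩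
      filter_upwards [Ico_mem_nhdsLT h] with t ht
      rw [concat_of_le ht.1]

theorem IsInput.inputNorm_concat_le (hu : sys.IsInput u) (hv : sys.IsInput v) (r : ℝ) :
    sys.inputNorm (ImpulsiveSwitchedSystem.concat u v r) ≤
      max (sys.inputNorm u) (sys.inputNorm v) := by
  refine inputNorm_le fun t ht => ?_
  rcases lt_or_ge t r with h | h
  · rw [concat_of_lt h]; exact (hu.norm_le ht).trans (le_max_left _ _)
  · rw [concat_of_le h]; exact (hv.norm_le ht).trans (le_max_right _ _)

variable {s : ℝ} {x₀ y₀ : EuclideanSpace ℝ (Fin n)} {x y : ℝ → EuclideanSpace ℝ (Fin n)}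

theorem IsSolution.restrict (hx : sys.IsSolution u s x₀ x) {t : ℝ} (hst : s ≤ t) :
    sys.IsSolution u t (x t) x where
  init := rfl
  mem r hr := hx.mem r (hst.trans hr)
  rightCont r hr := hx.rightCont r (hst.trans hr)
  absCont a b ha := hx.absCont a b (hst.trans ha)
  flow := by filter_upwards [hx.flow] with r hr htr using hr (hst.trans htr)
  leftLim i hi := hx.leftLim i (hst.trans_lt hi)
  jump i hi := hx.jump i (hst.trans_lt hi)

theorem IsSolution.congr_input (hx : sys.IsSolution u s x₀ x) (hu : sys.IsInput u)
    (h : ∀ t, s ≤ t → u t = v t) : sys.IsSolution v s x₀ x where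
  init := hx.init
  mem := hx.mem
  rightCont := hx.rightCont
  absCont := hx.absCont
  flow := by
    filter_upwards [hx.flow] with r hr hsr
    rw [← h r hsr]
    exact hr hsr
  leftLim := hx.leftLim
  jump i hi := by
    rw [hx.jump i hi, ImpulsiveSwitchedSystem.jump, ImpulsiveSwitchedSystem.jump,
      leftLim_congr hi (hu.tendsto_leftLim i) fun t ht => h t ht.1]

theorem IsSolution.tendsto_leftLim (hx : sys.IsSolution u s x₀ x) {i : ℕ}
    (hi : s < sys.σ.time (i + 1)) :
    Tendsto x (𝓝[<] sys.σ.time (i + 1)) (𝓝 (Function.leftLim x (sys.σ.time (i + 1)))) := by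
  obtain ⟨v, -, hv⟩ := hx.leftLim i hi
  exact tendsto_leftLim_of_tendsto ⟨v, hv⟩

theorem IsSolution.leftLim_mem (hx : sys.IsSolution u s x₀ x) {i : ℕ}
    (hi : s < sys.σ.time (i + 1)) : Function.leftLim x (sys.σ.time (i + 1)) ∈ sys.X := by
  obtain ⟨v, hvX, hv⟩ := hx.leftLim i hi
  rwa [leftLim_eq_of_tendsto hv]

theorem IsSolution.isFlow (hx : sys.IsSolution u s x₀ x) {i : ℕ} {a b : ℝ} (hsa : s ≤ a)
    (ha : sys.σ.time i ≤ a) (hb : b < sys.σ.time (i + 1)) : sys.IsFlow u a b x where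
  cont := by
    intro t ht
    rcases ht.1.eq_or_lt with rfl | hat
    · exact (hx.rightCont a hsa).mono Icc_subset_Ici_self
    -- Starting at the midpoint avoids `a`, which may be a switching instant.
    · have h1 : AbsolutelyContinuousOnInterval x ((a + t) / 2) b :=
        hx.absCont _ _ (by linarith) (by linarith [ht.2])
          (sys.σ.disjoint_instants (i := i) (by linarith) hb)
      have h2 := h1.continuousOn
      rw [uIcc_of_le (by linarith [ht.2])] at h2
      refine (h2 t ⟨by linarith, ht.2⟩).mono_of_mem_nhdsWithin ?_
      refine mem_of_superset (inter_mem_nhdsWithin (Icc a b)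
        (Ioi_mem_nhds (show (a + t) / 2 < t by linarith))) ?_
      rintro r ⟨h3, h4⟩
      exact ⟨(show (a + t) / 2 < r from h4).le, h3.2⟩
  mem t ht := hx.mem t (hsa.trans ht.1)
  absCont c d hc hcd hd := hx.absCont c d (hsa.trans hc.le) hcd
    (sys.σ.disjoint_instants (ha.trans_lt hc) (hd.trans hb))
  deriv := by
    filter_upwards [hx.flow] with t ht hmem using ht (hsa.trans hmem.1.le)

/-- Up to a switching instant, a solution is a flow once its value there is replaced by its left
limit. -/
theorem IsSolution.isFlow_update (hx : sys.IsSolution u s x₀ x) {i : ℕ} {a : ℝ} (hsa : s ≤ a)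
    (ha : sys.σ.time i ≤ a) (hb : a < sys.σ.time (i + 1)) :
    sys.IsFlow u a (sys.σ.time (i + 1)) (Function.update x (sys.σ.time (i + 1))
      (Function.leftLim x (sys.σ.time (i + 1)))) := by
  set b := sys.σ.time (i + 1) with hbdef
  have hlim := hx.tendsto_leftLim (hsa.trans_lt hb)
  have heq : ∀ t < b, Function.update x b (Function.leftLim x b) =ᶠ[𝓝 t] x := by
    intro t ht
    filter_upwards [Iio_mem_nhds ht] with r hr
    exact Function.update_of_ne (ne_of_lt hr) _ _
  refine ⟨?_, ?_, ?_, ?_⟩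
  · intro t ht
    rcases ht.2.eq_or_lt with rfl | htb
    · rw [continuousWithinAt_update_same]
      refine hlim.mono_left (nhdsWithin_mono _ ?_)
      rintro r ⟨h1, h2⟩
      exact lt_of_le_of_ne h1.2 h2
    · have hc := (hx.isFlow hsa ha (show (t + b) / 2 < b by linarith)).cont t
        ⟨ht.1, by linarith⟩
      have h2 : ContinuousWithinAt x (Icc a b) t := by
        refine hc.mono_of_mem_nhdsWithin ?_
        refine mem_of_superset (inter_mem_nhdsWithin (Icc a b)
          (Iio_mem_nhds (show t < (t + b) / 2 by linarith))) ?_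
        rintro r ⟨h3, h4⟩
        exact ⟨h3.1, (show r < (t + b) / 2 from h4).le⟩
      exact h2.congr_of_eventuallyEq ((heq t htb).filter_mono nhdsWithin_le_nhds)
        (heq t htb).self_of_nhds
  · intro t ht
    rcases ht.2.eq_or_lt with rfl | htb
    · rw [Function.update_self]
      exact hx.leftLim_mem (hsa.trans_lt hb)
    · rw [(heq t htb).self_of_nhds]
      exact hx.mem t (hsa.trans ht.1)
  · intro c d hc hcd hd
    have h1 := (hx.isFlow hsa ha (show (d + b) / 2 < b by linarith)).absCont c d hc hcd
      (by linarith)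
    refine h1.congr fun r hr => ?_
    rw [uIcc_of_le hcd] at hr
    exact (heq r (hr.2.trans_lt hd)).self_of_nhds.symm
  · filter_upwards [hx.flow] with t ht hmem
    rw [(heq t hmem.2).self_of_nhds]
    exact (ht (hsa.trans hmem.1.le)).congr_of_eventuallyEq (heq t hmem.2)

/-! ### Dependence on initial states, uniqueness and concatenation. -/

/-- On bounded time intervals, solutions depend on their initial states in a Lipschitz way. -/
theorem exists_lipschitz_initial (sys : ImpulsiveSwitchedSystem n m M) (K D : ℝ) (j : ℕ) :
    ∃ C : ℝ, 1 ≤ C ∧ ∀ s r : ℝ, sys.t₀ ≤ s → ∀ u v, sys.IsInput u → sys.inputNorm u ≤ D →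
      (∀ t ∈ Ico s r, u t = v t) → ∀ x₀ y₀ x y, sys.IsSolution u s x₀ x →
      sys.IsSolution v s y₀ y → (∀ t ∈ Icc s r, ‖x t‖ ≤ K ∧ ‖y t‖ ≤ K) →
      ∀ t ∈ Icc s r, t ≤ sys.σ.time j → ‖x t - y t‖ ≤ C * ‖x₀ - y₀‖ := by
  obtain ⟨L, hL⟩ := sys.exists_flowLipschitz K D
  obtain ⟨Lg, hLg⟩ := sys.exists_jumpLipschitz K D
  induction j with
  | zero =>
    refine ⟨1, le_rfl, fun s r hs u v hu huD huv x₀ y₀ x y hx hy hK t ht htj => ?_⟩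
    rw [sys.σ.time_zero] at htj
    have : t = s := le_antisymm (htj.trans hs) ht.1
    rw [this, hx.init, hy.init, one_mul]
  | succ j ih =>
    obtain ⟨C, hC1, hC⟩ := ih
    set E := Real.exp (L * (sys.σ.time (j + 1) - sys.σ.time j)) with hE
    have hE1 : 1 ≤ E := Real.one_le_exp (mul_nonneg hL.1 (by linarith [sys.σ.time_lt_succ j]))
    have hm1 : 1 ≤ max 1 Lg := le_max_left _ _
    have hCE : 1 ≤ C * E := one_le_mul_of_one_le_of_one_le hC1 hE1
    have hCEm : C * E ≤ C * E * max 1 Lg := le_mul_of_one_le_right (by linarith) hm1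
    -- Each interval contributes a Grönwall factor `E` and a jump factor `Lg`. The maximum with `1`
    -- keeps the constant valid at earlier times.
    refine ⟨C * E * max 1 Lg, by linarith,
      fun s r hs u v hu huD huv x₀ y₀ x y hx hy hK t ht htj => ?_⟩
    have hxy0 := norm_nonneg (x₀ - y₀)
    rcases le_or_gt t (sys.σ.time j) with htj' | htj'
    · refine (hC s r hs u v hu huD huv x₀ y₀ x y hx hy hK t ht htj').trans ?_
      gcongr
      exact (le_mul_of_one_le_right (by linarith) hE1).trans hCEm
    rcases ht.1.eq_or_lt with rfl | hst
    · rw [hx.init, hy.init]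
      exact le_mul_of_one_le_left hxy0 (by linarith)
    set s' := max s (sys.σ.time j) with hs'
    have hss' : s ≤ s' := le_max_left _ _
    have hjs' : sys.σ.time j ≤ s' := le_max_right _ _
    have hs't : s' < t := max_lt hst htj'
    have hstart : ‖x s' - y s'‖ ≤ C * ‖x₀ - y₀‖ := by
      rcases le_total s (sys.σ.time j) with h | h
      · rw [hs', max_eq_right h]
        exact hC s r hs u v hu huD huv x₀ y₀ x y hx hy hK _ ⟨h, htj'.le.trans ht.2⟩ le_rfl
      · rw [hs', max_eq_left h, hx.init, hy.init]
        exact le_mul_of_one_le_left hxy0 hC1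
    have hexp : Real.exp (L * (t - s')) ≤ E :=
      Real.exp_le_exp.2 (mul_le_mul_of_nonneg_left (by linarith) hL.1)
    have hup : ∀ q ∈ Ioo s' t, u q ∈ sys.U ∧ ‖u q‖ ≤ D := fun q hq =>
      have h := hs.trans (hss'.trans hq.1.le)
      ⟨hu.mem q h, (hu.norm_le h).trans huD⟩
    have huv' : ∀ q ∈ Ioo s' t, v q = u q := fun q hq =>
      (huv q ⟨hss'.trans hq.1.le, hq.2.trans_le ht.2⟩).symm
    have hmul : ‖x s' - y s'‖ * Real.exp (L * (t - s')) ≤ C * E * ‖x₀ - y₀‖ := by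
      calc _ ≤ (C * ‖x₀ - y₀‖) * E := by gcongr
        _ = _ := by ring
    -- At the switching instant itself the left limits are compared by Grönwall first, and then the
    -- jump map is applied.
    rcases htj.eq_or_lt with rfl | htlt
    · set b := sys.σ.time (j + 1) with hb
      have hlx := hx.tendsto_leftLim (hss'.trans_lt hs't)
      have hly := hy.tendsto_leftLim (hss'.trans_lt hs't)
      have hfx := hx.isFlow_update hss' hjs' hs't
      have hfy := (hy.isFlow_update hss' hjs' hs't).congr_input huv'
      rw [← hb] at hlx hly hfx hfy
      have hbK : ∀ {z : ℝ → EuclideanSpace ℝ (Fin n)},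
          Tendsto z (𝓝[<] b) (𝓝 (Function.leftLim z b)) → (∀ q ∈ Icc s r, ‖z q‖ ≤ K) →
          ∀ q ∈ Icc s' b, ‖Function.update z b (Function.leftLim z b) q‖ ≤ K := by
        intro z hz hzK q hq
        rcases hq.2.eq_or_lt with rfl | hqb
        · rw [Function.update_self]
          refine le_of_tendsto hz.norm ?_
          filter_upwards [Ico_mem_nhdsLT hst] with p hp using hzK p ⟨hp.1, hp.2.le.trans ht.2⟩
        · rw [Function.update_of_ne hqb.ne]
          exact hzK q ⟨hss'.trans hq.1, hqb.le.trans ht.2⟩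
      have hxK := hbK hlx fun q hq => (hK q hq).1
      have hyK := hbK hly fun q hq => (hK q hq).2
      have h1 := hfx.norm_sub_le_exp hL hfy (hs.trans hss') hup hxK hyK b
        (right_mem_Icc.2 hs't.le)
      rw [Function.update_of_ne hs't.ne, Function.update_of_ne hs't.ne] at h1
      have hxb := hxK b (right_mem_Icc.2 hs't.le)
      have hyb := hyK b (right_mem_Icc.2 hs't.le)
      rw [Function.update_self] at hxb hyb
      rw [Function.update_self, Function.update_self] at h1
      have hjx := hx.jump j hst
      have hjy := hy.jump j hst
      rw [ImpulsiveSwitchedSystem.jump] at hjx hjy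
      rw [← hb] at hjx hjy
      rw [← leftLim_congr hst (hu.tendsto_leftLim j)
        (fun q hq => huv q ⟨hq.1, hq.2.trans_le ht.2⟩)] at hjy
      rw [hjx, hjy]
      calc _ ≤ Lg * ‖Function.leftLim x b - Function.leftLim y b‖ :=
            hLg.2 _ _ (sys.σ.t₀_le_time _) _ (hu.leftLim_mem j) ((hu.norm_leftLim_le j).trans huD)
              _ (hx.leftLim_mem hst) _ (hy.leftLim_mem hst) hxb hyb
        _ ≤ max 1 Lg * (C * E * ‖x₀ - y₀‖) := by
            gcongr
            · exact le_max_right _ _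
            · exact h1.trans hmul
        _ = _ := by ring
    · have hfx := hx.isFlow hss' hjs' htlt
      have hfy := (hy.isFlow hss' hjs' htlt).congr_input huv'
      have h1 := hfx.norm_sub_le_exp hL hfy (hs.trans hss') hup
        (fun q hq => (hK q ⟨hss'.trans hq.1, hq.2.trans ht.2⟩).1)
        (fun q hq => (hK q ⟨hss'.trans hq.1, hq.2.trans ht.2⟩).2) t (right_mem_Icc.2 hs't.le)
      refine h1.trans (hmul.trans ?_)
      gcongr

theorem IsRobustlyForwardComplete.exists_bound (hc : sys.IsRobustlyForwardComplete)
    (hs : sys.t₀ ≤ s) (hu : sys.IsInput u) (hx : sys.IsSolution u s x₀ x) (r : ℝ) :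
    ∃ K, ∀ t ∈ Icc s r, ‖x t‖ ≤ K := by
  obtain ⟨K, hK⟩ := (hc s hs).2 (‖x₀‖ + 1) (sys.inputNorm u + 1) (max (r - s) 1)
    (by positivity) (by linarith [sys.inputNorm_nonneg u]) (by positivity)
  refine ⟨K, fun t ht => hK x₀ ?_ (by linarith) u hu (by linarith) x hx t
    ⟨ht.1, ht.2.trans (by linarith [le_max_left (r - s) 1])⟩⟩
  rw [← hx.init]
  exact hx.mem s le_rfl

/-- Solutions with the same initial state coincide as long as their inputs do. -/
theorem IsRobustlyForwardComplete.solution_unique (hc : sys.IsRobustlyForwardComplete)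
    (hs : sys.t₀ ≤ s) (hu : sys.IsInput u) (hv : sys.IsInput v) {r : ℝ}
    (huv : ∀ t ∈ Ico s r, u t = v t) (hx : sys.IsSolution u s x₀ x)
    (hy : sys.IsSolution v s x₀ y) : ∀ t ∈ Icc s r, x t = y t := by
  intro t ht
  obtain ⟨K₁, hK₁⟩ := hc.exists_bound hs hu hx r
  obtain ⟨K₂, hK₂⟩ := hc.exists_bound hs hv hy r
  obtain ⟨j, hj⟩ := sys.σ.exists_le_time t
  obtain ⟨C, -, hC⟩ := sys.exists_lipschitz_initial (max K₁ K₂) (sys.inputNorm u) j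
  have := hC s r hs u v hu le_rfl huv x₀ x₀ x y hx hy (fun q hq =>
    ⟨(hK₁ q hq).trans (le_max_left _ _), (hK₂ q hq).trans (le_max_right _ _)⟩) t ht hj
  rw [sub_self, norm_zero, mul_zero] at this
  exact sub_eq_zero.1 (norm_le_zero_iff.1 this)

/-- Following `x` up to time `r` and then `y` is a solution for the concatenated input. -/
theorem IsRobustlyForwardComplete.exists_concat (hc : sys.IsRobustlyForwardComplete)
    (hs : sys.t₀ ≤ s) (hu : sys.IsInput u) (hv : sys.IsInput v) {r : ℝ} (hsr : s ≤ r)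
    (hx : sys.IsSolution u s x₀ x) (hy : sys.IsSolution v r (x r) y) :
    ∃ z, sys.IsSolution (concat u v r) s x₀ z ∧ (∀ t ∈ Icc s r, z t = x t) ∧
      ∀ t, r ≤ t → z t = y t := by
  have huv := hu.concat hv r
  have hx₀ : x₀ ∈ sys.X := hx.init ▸ hx.mem s le_rfl
  -- Nothing is glued by hand: completeness supplies a solution for the concatenated input, and
  -- uniqueness identifies it with `x` and then with `y`.
  obtain ⟨z, hz⟩ := (hc s hs).1 x₀ hx₀ _ huv
  have h1 : ∀ t ∈ Icc s r, z t = x t :=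
    hc.solution_unique hs huv hu (fun t ht => concat_of_lt ht.2) hz hx
  refine ⟨z, hz, h1, fun t ht => ?_⟩
  have h2 := hz.restrict hsr
  rw [h1 r ⟨hsr, le_rfl⟩] at h2
  exact hc.solution_unique (hs.trans hsr) huv hv (r := t) (fun q hq => concat_of_le hq.1) h2 hy t
    ⟨ht, le_rfl⟩

/-- The estimate of input-to-state stability, with gains `β` and `γ`. -/
def HasISSEstimate (sys : ImpulsiveSwitchedSystem n m M) (β : ℝ → ℝ → ℝ) (γ : ℝ → ℝ) : Prop :=
  ∀ s, sys.t₀ ≤ s → ∀ x₀ ∈ sys.X, ∀ u, sys.IsInput u → ∃ x, sys.IsSolution u s x₀ x ∧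
    ∀ t, s ≤ t → ‖x t‖ ≤ β ‖x₀‖ (t - s) + γ (sys.inputNorm u)

/-- ISS provides the estimate for one solution only; uniqueness extends it to all. -/
theorem IsSolution.norm_le {β : ℝ → ℝ → ℝ} {γ : ℝ → ℝ} (hx : sys.IsSolution u s x₀ x)
    (hc : sys.IsRobustlyForwardComplete) (hI : sys.HasISSEstimate β γ) (hs : sys.t₀ ≤ s)
    (hu : sys.IsInput u) {t : ℝ} (ht : s ≤ t) :
    ‖x t‖ ≤ β ‖x₀‖ (t - s) + γ (sys.inputNorm u) := by
  obtain ⟨y, hy, hbd⟩ := hI s hs x₀ (hx.init ▸ hx.mem s le_rfl) u hu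
  rw [hc.solution_unique hs hu hu (fun _ _ => rfl) hx hy t ⟨ht, le_rfl⟩]
  exact hbd t ht

end ImpulsiveSwitchedSystem

/-! ### Order properties of comparison functions. -/

theorem ClassK.nonneg {γ : ℝ → ℝ} (h : ClassK γ) {r : ℝ} (hr : 0 ≤ r) : 0 ≤ γ r :=
  h.map_zero.symm.trans_le (h.strictMonoOn.monotoneOn self_mem_Ici hr hr)

theorem ClassK.mono {γ : ℝ → ℝ} (h : ClassK γ) {r s : ℝ} (hr : 0 ≤ r) (hrs : r ≤ s) : γ r ≤ γ s :=
  h.strictMonoOn.monotoneOn hr (hr.trans hrs) hrs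

theorem ClassKL.nonneg {β : ℝ → ℝ → ℝ} (h : ClassKL β) {r t : ℝ} (hr : 0 ≤ r) (ht : 0 ≤ t) :
    0 ≤ β r t :=
  (h.classK t ht).nonneg hr

theorem ClassKL.mono {β : ℝ → ℝ → ℝ} (h : ClassKL β) {r s t : ℝ} (hr : 0 ≤ r) (hrs : r ≤ s)
    (ht : 0 ≤ t) : β r t ≤ β s t :=
  (h.classK t ht).mono hr hrs

theorem ClassKL.anti {β : ℝ → ℝ → ℝ} (h : ClassKL β) {r s t : ℝ} (hr : 0 ≤ r) (hs : 0 ≤ s)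
    (hst : s ≤ t) : β r t ≤ β r s := by
  rcases hr.eq_or_lt with rfl | hr
  · rw [(h.classK t (hs.trans hst)).map_zero, (h.classK s hs).map_zero]
  · exact (h.strictAntiOn r hr).antitoneOn hs (hs.trans hst) hst

theorem norm_le_sum_abs {n : ℕ} (x : EuclideanSpace ℝ (Fin n)) :
    ‖x‖ ≤ ∑ j, |x j| := by
  rw [EuclideanSpace.norm_eq]
  refine Real.sqrt_le_iff.2 ⟨Finset.sum_nonneg fun _ _ => abs_nonneg _, ?_⟩
  exact Finset.sum_sq_le_sq_sum_of_nonneg fun j _ => abs_nonneg (x j)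

/-! ### Chains of inputs and uniform smallness of displacements. -/

namespace ImpulsiveSwitchedSystem

variable {n m : ℕ} {M : Type*} {sys : ImpulsiveSwitchedSystem n m M}

/-- There is an input under which all bounded flows on `[s, s']` move in direction `v` at least
`N * ε` further than the reference curve `z₀`, up to an error linear in the duration. -/
def HasChain (sys : ImpulsiveSwitchedSystem n m M) (K D ε C : ℝ)
    (v : EuclideanSpace ℝ (Fin n)) (z₀ : ℝ → EuclideanSpace ℝ (Fin n)) (N : ℕ) (s s' : ℝ) : Prop :=
  ∃ u, sys.IsInput u ∧ sys.inputNorm u ≤ D ∧ ∀ w, sys.IsFlow u s s' w →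
    (∀ t ∈ Icc s s', ‖w t‖ ≤ K) →
      N * ε - C * (s' - s) ≤ inner ℝ v ((w s' - w s) - (z₀ s' - z₀ s))

section Chain

variable {K D ε L : ℝ} {v : EuclideanSpace ℝ (Fin n)} {z₀ z : ℝ → EuclideanSpace ℝ (Fin n)}
  {u : ℝ → EuclideanSpace ℝ (Fin m)} {N N' : ℕ} {s s' s'' : ℝ}

theorem IsInput.mem_and_norm_le (hu : sys.IsInput u) (huD : sys.inputNorm u ≤ D)
    (hs : sys.t₀ ≤ s) : ∀ t ∈ Ioo s s', u t ∈ sys.U ∧ ‖u t‖ ≤ D := fun _ ht =>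
  ⟨hu.mem _ (hs.trans ht.1.le), (hu.norm_le (hs.trans ht.1.le)).trans huD⟩

/-- A single observed flow controls all bounded flows with its input, since their displacements
agree up to a linear error. -/
theorem hasChain_of_flow (hL : sys.FlowLipschitz K D L) (hv : ‖v‖ ≤ 1) (hs : sys.t₀ ≤ s)
    (hss' : s ≤ s') (hu : sys.IsInput u) (huD : sys.inputNorm u ≤ D) (hz : sys.IsFlow u s s' z)
    (hzK : ∀ t ∈ Icc s s', ‖z t‖ ≤ K)
    (hN : N * ε ≤ inner ℝ v ((z s' - z s) - (z₀ s' - z₀ s))) :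
    sys.HasChain K D ε (L * (2 * K)) v z₀ N s s' := by
  refine ⟨u, hu, huD, fun w hw hwK => ?_⟩
  have h1 := hz.norm_displacement_sub_le' hL hw hs hss' (hu.mem_and_norm_le huD hs) hzK hwK
  have h2 : inner ℝ v ((z s' - z s) - (w s' - w s)) ≤ L * (2 * K) * (s' - s) :=
    (real_inner_le_norm _ _).trans
      ((mul_le_of_le_one_left (norm_nonneg _) hv).trans h1)
  rw [inner_sub_right] at h2 hN ⊢
  linarith

/-- Gains accumulate under concatenation, while the errors add up only to `C` times the total
duration. -/
theorem HasChain.add {C : ℝ} (h : sys.HasChain K D ε C v z₀ N s s')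
    (h' : sys.HasChain K D ε C v z₀ N' s' s'') (hss' : s ≤ s') (hs's'' : s' ≤ s'') :
    sys.HasChain K D ε C v z₀ (N + N') s s'' := by
  obtain ⟨u, hu, huD, H⟩ := h
  obtain ⟨u', hu', hu'D, H'⟩ := h'
  refine ⟨concat u u' s', hu.concat hu' _,
    (hu.inputNorm_concat_le hu' _).trans (max_le huD hu'D), fun w hw hwK => ?_⟩
  have h1 := H w ((hw.mono le_rfl hs's'').congr_input fun t ht => concat_of_lt ht.2)
    fun t ht => hwK t ⟨ht.1, ht.2.trans hs's''⟩
  have h2 := H' w ((hw.mono hss' le_rfl).congr_input fun t ht => concat_of_le ht.1.le)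
    fun t ht => hwK t ⟨hss'.trans ht.1, ht.2⟩
  simp only [inner_sub_right] at h1 h2 ⊢
  push_cast
  linarith

end Chain

section Displacement

variable {β : ℝ → ℝ → ℝ} {γ : ℝ → ℝ}

theorem IsSolution.norm_le_of_le (hc : sys.IsRobustlyForwardComplete)
    (hI : sys.HasISSEstimate β γ) (hβ : ClassKL β) (hγ : ClassK γ) {u s x₀ x}
    (hx : sys.IsSolution u s x₀ x) (hs : sys.t₀ ≤ s) (hu : sys.IsInput u) {R D : ℝ}
    (hR : ‖x₀‖ ≤ R) (hD : sys.inputNorm u ≤ D) {t : ℝ} (ht : s ≤ t) :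
    ‖x t‖ ≤ β R 0 + γ D := by
  refine (hx.norm_le hc hI hs hu ht).trans (add_le_add ?_ (hγ.mono (inputNorm_nonneg u) hD))
  exact (hβ.anti (norm_nonneg _) le_rfl (by linarith)).trans (hβ.mono (norm_nonneg _) hR le_rfl)

/-- Chains of a fixed `ε` on bounded intervals cannot be arbitrarily long. -/
theorem not_forall_exists_hasChain (hc : sys.IsRobustlyForwardComplete)
    (hI : sys.HasISSEstimate β γ) (hβ : ClassKL β) (hγ : ClassK γ) {i : ℕ} {K D ε C K₀ : ℝ}
    (hε : 0 < ε) (hC : 0 ≤ C) {v : EuclideanSpace ℝ (Fin n)} (hv : ‖v‖ ≤ 1)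
    {z₀ : ℝ → EuclideanSpace ℝ (Fin n)} {a b : ℝ} (ha : sys.σ.time i ≤ a)
    (hb : b ≤ sys.σ.time (i + 1))
    (hz₀ : ∀ t, a ≤ t → z₀ t ∈ sys.X ∧ ‖z₀ t‖ ≤ K₀) (hK₀ : K₀ ≤ K) (hK : β K₀ 0 + γ D ≤ K) :
    ¬ ∀ N : ℕ, ∃ s s', a ≤ s ∧ s ≤ s' ∧ s' < b ∧ sys.HasChain K D ε C v z₀ N s s' := by
  intro H
  -- The gain `N * ε` exceeds the total error `C * (b - a)` plus `4 * K`, the largest relative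
  -- displacement of two curves bounded by `K`.
  obtain ⟨N, hN⟩ := exists_nat_gt ((C * (b - a) + 4 * K) / ε)
  rw [div_lt_iff₀ hε] at hN
  obtain ⟨s, s', has, hss', hs'b, u, hu, huD, hchain⟩ := H N
  have hs : sys.t₀ ≤ s := (sys.σ.t₀_le_time i).trans (ha.trans has)
  obtain ⟨w, hw⟩ := (hc s hs).1 (z₀ s) (hz₀ s has).1 u hu
  have hwK : ∀ t ∈ Icc s s', ‖w t‖ ≤ K := fun t ht =>
    (hw.norm_le_of_le hc hI hβ hγ hs hu (hz₀ s has).2 huD ht.1).trans hK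
  have h1 := hchain w (hw.isFlow le_rfl (ha.trans has) (hs'b.trans_le hb)) hwK
  have h2 : inner ℝ v ((w s' - w s) - (z₀ s' - z₀ s)) ≤ 4 * K := by
    refine (real_inner_le_norm _ _).trans ((mul_le_of_le_one_left (norm_nonneg _) hv).trans ?_)
    refine (norm_sub_le _ _).trans ((add_le_add (norm_sub_le _ _) (norm_sub_le _ _)).trans ?_)
    linarith [hwK s ⟨le_rfl, hss'⟩, hwK s' ⟨hss', le_rfl⟩, (hz₀ s has).2,
      (hz₀ s' (has.trans hss')).2]
  have h3 : C * (s' - s) ≤ C * (b - a) := mul_le_mul_of_nonneg_left (by linarith) hC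
  linarith

/-- All bounded flows on `[s, s']` with inputs bounded by `D` have displacement at most `η`. -/
def SmallDisplacement (sys : ImpulsiveSwitchedSystem n m M) (K D η s s' : ℝ) : Prop :=
  ∀ u, sys.IsInput u → sys.inputNorm u ≤ D → ∀ z, sys.IsFlow u s s' z →
    (∀ t ∈ Icc s s', ‖z t‖ ≤ K) → ‖z s' - z s‖ ≤ η

/-- Displacements are small along a filter on times if they are close to those of one reference
curve in every direction. -/
theorem eventually_smallDisplacement_of_inner {K D η : ℝ} (hη : 0 < η)
    {z₀ : ℝ → EuclideanSpace ℝ (Fin n)} {y : EuclideanSpace ℝ (Fin n)} {F : Filter ℝ}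
    (hz₀ : Tendsto z₀ F (𝓝 y))
    (H : ∀ v : EuclideanSpace ℝ (Fin n), ‖v‖ ≤ 1 → ∀ ε > 0, ∀ᶠ p : ℝ × ℝ in F ×ˢ F, p.1 ≤ p.2 →
      ∀ u, sys.IsInput u → sys.inputNorm u ≤ D → ∀ z, sys.IsFlow u p.1 p.2 z →
        (∀ t ∈ Icc p.1 p.2, ‖z t‖ ≤ K) →
        inner ℝ v ((z p.2 - z p.1) - (z₀ p.2 - z₀ p.1)) < ε) :
    ∀ᶠ p : ℝ × ℝ in F ×ˢ F, p.1 ≤ p.2 → sys.SmallDisplacement K D η p.1 p.2 := by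
  -- Testing with `±` the coordinate vectors bounds every coordinate; `n + 1` covers `n = 0`.
  have hε : 0 < η / 2 / (n + 1) := by positivity
  have h1 : ∀ j : Fin n, _ := fun j => H (EuclideanSpace.single j 1) (by simp) _ hε
  have h2 : ∀ j : Fin n, _ := fun j => H (-EuclideanSpace.single j 1) (by simp) _ hε
  have h3 : Tendsto (fun p : ℝ × ℝ => ‖z₀ p.2 - z₀ p.1‖) (F ×ˢ F) (𝓝 0) := by
    have := ((hz₀.comp tendsto_snd).sub (hz₀.comp tendsto_fst)).norm
    rwa [sub_self, norm_zero] at this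
  filter_upwards [eventually_all.2 h1, eventually_all.2 h2,
    h3.eventually (Iio_mem_nhds (half_pos hη))] with p hp1 hp2 hp3 hp u hu huD z hz hzK
  have h4 : ‖(z p.2 - z p.1) - (z₀ p.2 - z₀ p.1)‖ ≤ η / 2 := by
    refine (norm_le_sum_abs _).trans ?_
    have h5 : ∀ j ∈ Finset.univ, |((z p.2 - z p.1) - (z₀ p.2 - z₀ p.1)) j| ≤ η / 2 / (n + 1) := by
      intro j _
      have h6 := hp1 j hp u hu huD z hz hzK
      have h7 := hp2 j hp u hu huD z hz hzK
      rw [inner_neg_left] at h7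
      rw [EuclideanSpace.inner_single_left] at h6 h7
      simp only [map_one, one_mul] at h6 h7
      rw [abs_le]
      constructor <;> linarith
    refine (Finset.sum_le_card_nsmul _ _ _ h5).trans ?_
    rw [Finset.card_univ, Fintype.card_fin, nsmul_eq_mul, mul_div_assoc', div_le_iff₀ (by positivity)]
    nlinarith
  have h5 := norm_sub_norm_le (z p.2 - z p.1) (z₀ p.2 - z₀ p.1)
  have h6 : ‖z₀ p.2 - z₀ p.1‖ < η / 2 := hp3
  linarith

/-- Just before any time, displacements are uniformly small. -/
theorem exists_smallDisplacement_left (hc : sys.IsRobustlyForwardComplete)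
    (hI : sys.HasISSEstimate β γ) (hβ : ClassKL β) (hγ : ClassK γ) {i : ℕ} {b : ℝ}
    (hb : sys.σ.time i < b) (hb' : b ≤ sys.σ.time (i + 1)) (K D : ℝ) {η : ℝ} (hη : 0 < η) :
    ∃ l, sys.σ.time i ≤ l ∧ l < b ∧
      ∀ s s', l < s → s ≤ s' → s' ≤ b → sys.SmallDisplacement K D η s s' := by
  -- Without an admissible input or a state there is no reference solution, but the claim is
  -- vacuous.
  by_cases hex : (∃ u, sys.IsInput u ∧ sys.inputNorm u ≤ D) ∧ sys.X.Nonempty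
  swap
  · refine ⟨sys.σ.time i, le_rfl, hb, fun s s' _ hss' _ u hu huD z hz _ => ?_⟩
    exact absurd ⟨⟨u, hu, huD⟩, ⟨_, hz.mem s ⟨le_rfl, hss'⟩⟩⟩ hex
  obtain ⟨⟨u₀, hu₀, hu₀D⟩, x₀, hx₀⟩ := hex
  set a := sys.σ.time i with ha
  have hta : sys.t₀ ≤ a := sys.σ.t₀_le_time i
  obtain ⟨z₀, hz₀⟩ := (hc a hta).1 x₀ hx₀ u₀ hu₀
  set K₀ := β ‖x₀‖ 0 + γ D
  have hz₀K : ∀ t, a ≤ t → z₀ t ∈ sys.X ∧ ‖z₀ t‖ ≤ K₀ := fun t ht =>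
    ⟨hz₀.mem t ht, hz₀.norm_le_of_le hc hI hβ hγ hta hu₀ le_rfl hu₀D ht⟩
  -- Large enough for the given flows, the reference solution, and solutions starting on it with
  -- inputs bounded by `D`.
  set K' := max K (max K₀ (β K₀ 0 + γ D))
  have hKK' : K ≤ K' := le_max_left _ _
  have hK₀K' : K₀ ≤ K' := (le_max_left _ _).trans (le_max_right _ _)
  obtain ⟨L, hL⟩ := sys.exists_flowLipschitz K' D
  have hK'0 : 0 ≤ K' := (norm_nonneg _).trans ((hz₀K a le_rfl).2.trans hK₀K')
  obtain ⟨y, hy⟩ : ∃ y, Tendsto z₀ (𝓝[<] b) (𝓝 y) := by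
    rcases hb'.eq_or_lt with rfl | hlt
    · exact ⟨_, hz₀.tendsto_leftLim hb⟩
    · refine ⟨_, ((hz₀.isFlow le_rfl le_rfl hlt).cont b (right_mem_Icc.2 hb.le)).tendsto.mono_left
        ?_⟩
      rw [nhdsWithin_le_iff]
      exact mem_of_superset (Ico_mem_nhdsLT hb) Ico_subset_Icc_self
  have key := eventually_smallDisplacement_of_inner (sys := sys) (K := K) (D := D) hη hy ?_
  · obtain ⟨A, hA, hAsub⟩ := mem_prod_self_iff.1 key
    obtain ⟨l, hl, hlA⟩ := mem_nhdsLT_iff_exists_Ioo_subset.1 hA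
    refine ⟨max l a, le_max_right _ _, max_lt hl hb, fun s s' hs hss' hs'b => ?_⟩
    have hls := (le_max_left l a).trans_lt hs
    have hlt : ∀ q, s ≤ q → q < b → sys.SmallDisplacement K D η s q := fun q hsq hqb =>
      hAsub (mk_mem_prod (hlA ⟨hls, hsq.trans_lt hqb⟩) (hlA ⟨hls.trans_le hsq, hqb⟩)) hsq
    rcases hs'b.eq_or_lt with rfl | hs'b
    · intro u hu huD z hz hzK
      rcases hss'.eq_or_lt with rfl | hss'
      · simpa using hη.le
      · have hlim : Tendsto z (𝓝[<] s') (𝓝 (z s')) := by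
          refine (hz.cont s' (right_mem_Icc.2 hss'.le)).tendsto.mono_left ?_
          rw [nhdsWithin_le_iff]
          exact mem_of_superset (Ico_mem_nhdsLT hss') Ico_subset_Icc_self
        refine le_of_tendsto (hlim.sub_const (z s)).norm ?_
        filter_upwards [Ico_mem_nhdsLT hss'] with q hq
        exact hlt q hq.1 hq.2 u hu huD z (hz.mono le_rfl hq.2.le)
          fun t ht => hzK t ⟨ht.1, ht.2.trans hq.2.le⟩
    · exact hlt s' hss' hs'b
  · intro v hv ε hε
    by_contra hfreq
    rw [not_eventually] at hfreq
    refine not_forall_exists_hasChain hc hI hβ hγ (i := i) (a := a) hε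
      (mul_nonneg hL.1 (by positivity : (0 : ℝ) ≤ 2 * K')) hv le_rfl hb' hz₀K hK₀K'
      ((le_max_right _ _).trans (le_max_right _ _) : β K₀ 0 + γ D ≤ K') fun N => ?_
    suffices ∃ r, a ≤ r ∧ r < b ∧ sys.HasChain K' D ε (L * (2 * K')) v z₀ N a r by
      obtain ⟨r, h1, h2, h3⟩ := this
      exact ⟨a, r, le_rfl, h1, h2, h3⟩
    -- The reference input fills gaps with zero gain. Bad intervals occur arbitrarily close to `b`,
    -- so a chain ending at `r < b` can always be extended to the right.
    have hfill : ∀ s s', a ≤ s → s ≤ s' → s' < b →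
        sys.HasChain K' D ε (L * (2 * K')) v z₀ 0 s s' := fun s s' hs hss' hs' =>
      hasChain_of_flow hL hv (hta.trans hs) hss' hu₀ hu₀D
        (hz₀.isFlow hs hs (hs'.trans_le hb')) (fun t ht => (hz₀K t (hs.trans ht.1)).2.trans hK₀K')
        (by simp)
    induction N with
    | zero => exact ⟨a, le_rfl, hb, hfill a a le_rfl le_rfl hb⟩
    | succ N ih =>
      obtain ⟨r, har, hrb, hN⟩ := ih
      obtain ⟨⟨s, s'⟩, hp, hps, hps'⟩ := (hfreq.and_eventually
        (prod_mem_prod (Ioo_mem_nhdsLT hrb) (Ioo_mem_nhdsLT hrb))).exists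
      dsimp only at hp hps hps'
      push Not at hp
      obtain ⟨hss', u, hu, huD, z, hz, hzK, hbad⟩ := hp
      refine ⟨s', har.trans hps'.1.le, hps'.2, ?_⟩
      refine (hN.add (hfill r s har hps.1.le hps.2) har hps.1.le).add
        (hasChain_of_flow hL hv (hta.trans (har.trans hps.1.le)) hss' hu huD hz
          (fun t ht => (hzK t ht).trans hKK') ?_) (har.trans hps.1.le) hss'
      simpa using hbad

/-- Just after any time, displacements are uniformly small. -/
theorem exists_smallDisplacement_right (hc : sys.IsRobustlyForwardComplete)
    (hI : sys.HasISSEstimate β γ) (hβ : ClassKL β) (hγ : ClassK γ) {i : ℕ} {a : ℝ}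
    (ha : sys.σ.time i ≤ a) (ha' : a < sys.σ.time (i + 1)) (K D : ℝ) {η : ℝ} (hη : 0 < η) :
    ∃ l, a < l ∧ l ≤ sys.σ.time (i + 1) ∧
      ∀ s s', a ≤ s → s ≤ s' → s' < l → sys.SmallDisplacement K D η s s' := by
  by_cases hex : (∃ u, sys.IsInput u ∧ sys.inputNorm u ≤ D) ∧ sys.X.Nonempty
  swap
  · refine ⟨sys.σ.time (i + 1), ha', le_rfl, fun s s' _ hss' _ u hu huD z hz _ => ?_⟩
    exact absurd ⟨⟨u, hu, huD⟩, ⟨_, hz.mem s ⟨le_rfl, hss'⟩⟩⟩ hex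
  obtain ⟨⟨u₀, hu₀, hu₀D⟩, x₀, hx₀⟩ := hex
  set b := sys.σ.time (i + 1) with hb
  have hta : sys.t₀ ≤ a := (sys.σ.t₀_le_time i).trans ha
  obtain ⟨z₀, hz₀⟩ := (hc a hta).1 x₀ hx₀ u₀ hu₀
  set K₀ := β ‖x₀‖ 0 + γ D
  have hz₀K : ∀ t, a ≤ t → z₀ t ∈ sys.X ∧ ‖z₀ t‖ ≤ K₀ := fun t ht =>
    ⟨hz₀.mem t ht, hz₀.norm_le_of_le hc hI hβ hγ hta hu₀ le_rfl hu₀D ht⟩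
  set K' := max K (max K₀ (β K₀ 0 + γ D))
  have hKK' : K ≤ K' := le_max_left _ _
  have hK₀K' : K₀ ≤ K' := (le_max_left _ _).trans (le_max_right _ _)
  obtain ⟨L, hL⟩ := sys.exists_flowLipschitz K' D
  have hK'0 : 0 ≤ K' := (norm_nonneg _).trans ((hz₀K a le_rfl).2.trans hK₀K')
  have hy : Tendsto z₀ (𝓝[>] a) (𝓝 (z₀ a)) :=
    (hz₀.rightCont a le_rfl).tendsto.mono_left (nhdsWithin_mono _ Ioi_subset_Ici_self)
  have key := eventually_smallDisplacement_of_inner (sys := sys) (K := K) (D := D) hη hy ?_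
  · obtain ⟨A, hA, hAsub⟩ := mem_prod_self_iff.1 key
    obtain ⟨l, hl, hlA⟩ := mem_nhdsGT_iff_exists_Ioo_subset.1 hA
    refine ⟨min l b, lt_min hl ha', min_le_right _ _, fun s s' hs hss' hs'l => ?_⟩
    have hls := hs'l.trans_le (min_le_left l b)
    have hlt : ∀ q, a < q → q ≤ s' → sys.SmallDisplacement K D η q s' := fun q haq hqs' =>
      hAsub (mk_mem_prod (hlA ⟨haq, hqs'.trans_lt hls⟩) (hlA ⟨haq.trans_le hqs', hls⟩)) hqs'
    rcases hs.eq_or_lt with rfl | hs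
    · intro u hu huD z hz hzK
      rcases hss'.eq_or_lt with rfl | hss'
      · simpa using hη.le
      · have hlim : Tendsto z (𝓝[>] a) (𝓝 (z a)) := by
          refine (hz.cont a (left_mem_Icc.2 hss'.le)).tendsto.mono_left ?_
          rw [nhdsWithin_le_iff]
          exact mem_of_superset (Ioc_mem_nhdsGT hss') Ioc_subset_Icc_self
        refine le_of_tendsto (hlim.const_sub (z s')).norm ?_
        filter_upwards [Ioc_mem_nhdsGT hss'] with q hq
        exact hlt q hq.1 hq.2 u hu huD z (hz.mono hq.1.le le_rfl)
          fun t ht => hzK t ⟨hq.1.le.trans ht.1, ht.2⟩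
    · exact hlt s hs hss'
  · intro v hv ε hε
    by_contra hfreq
    rw [not_eventually] at hfreq
    refine not_forall_exists_hasChain hc hI hβ hγ (i := i) (a := a) hε
      (mul_nonneg hL.1 (by positivity : (0 : ℝ) ≤ 2 * K')) hv ha le_rfl hz₀K hK₀K'
      ((le_max_right _ _).trans (le_max_right _ _) : β K₀ 0 + γ D ≤ K') fun N => ?_
    obtain ⟨c, hac, hcb⟩ := exists_between ha'
    suffices ∃ r, a < r ∧ r ≤ c ∧ sys.HasChain K' D ε (L * (2 * K')) v z₀ N r c by
      obtain ⟨r, h1, h2, h3⟩ := this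
      exact ⟨r, c, h1.le, h2, hcb, h3⟩
    -- Now bad intervals accumulate at `a` from the right, so the chain keeps its end `c` and grows
    -- backwards.
    have hfill : ∀ s s', a ≤ s → s ≤ s' → s' < b →
        sys.HasChain K' D ε (L * (2 * K')) v z₀ 0 s s' := fun s s' hs hss' hs' =>
      hasChain_of_flow hL hv (hta.trans hs) hss' hu₀ hu₀D
        (hz₀.isFlow hs (ha.trans hs) hs')
        (fun t ht => (hz₀K t (hs.trans ht.1)).2.trans hK₀K') (by simp)
    induction N with
    | zero => exact ⟨c, hac, le_rfl, hfill c c hac.le le_rfl hcb⟩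
    | succ N ih =>
      obtain ⟨r, har, hrc, hN⟩ := ih
      obtain ⟨⟨s, s'⟩, hp, hps, hps'⟩ := (hfreq.and_eventually
        (prod_mem_prod (Ioo_mem_nhdsGT har) (Ioo_mem_nhdsGT har))).exists
      dsimp only at hp hps hps'
      push Not at hp
      obtain ⟨hss', u, hu, huD, z, hz, hzK, hbad⟩ := hp
      refine ⟨s, hps.1, hps.2.le.trans hrc, ?_⟩
      have h1 : sys.HasChain K' D ε (L * (2 * K')) v z₀ 1 s s' :=
        hasChain_of_flow hL hv (hta.trans hps.1.le) hss' hu huD hz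
          (fun t ht => (hzK t ht).trans hKK') (by simpa using hbad)
      have h2 := h1.add ((hfill s' r hps'.1.le hps'.2.le (hrc.trans_lt hcb)).add hN hps'.2.le hrc)
        hss' (hps'.2.le.trans hrc)
      rwa [zero_add, add_comm 1 N] at h2

end Displacement
end ImpulsiveSwitchedSystem

/-! ### Weight, gate and decay rate. -/

theorem ClassKL.exists_forall_le {β : ℝ → ℝ → ℝ} (h : ClassKL β) {r ε : ℝ} (hr : 0 ≤ r)
    (hε : 0 < ε) : ∃ T, 0 ≤ T ∧ ∀ τ, T ≤ τ → β r τ < ε := by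
  rcases hr.eq_or_lt with rfl | hr
  · exact ⟨0, le_rfl, fun τ hτ => by rwa [(h.classK τ hτ).map_zero]⟩
  · obtain ⟨T, hT⟩ := eventually_atTop.1 ((h.tendsto_zero r hr).eventually (Iio_mem_nhds hε))
    exact ⟨max T 0, le_max_right _ _, fun τ hτ => hT τ ((le_max_left _ _).trans hτ)⟩

/-- A bounded increasing weight on elapsed times. -/
def weight (τ : ℝ) : ℝ := 2 - 1 / (1 + τ)

theorem weight_zero : weight 0 = 1 := by norm_num [weight]

theorem weight_add_sub {τ h : ℝ} (hτ : 0 ≤ τ) (hh : 0 ≤ h) :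
    weight (τ + h) - weight τ = h / ((1 + τ) * (1 + τ + h)) := by
  have h1 : 1 + τ ≠ 0 := by positivity
  have h2 : 1 + τ + h ≠ 0 := by positivity
  rw [weight, weight, ← add_assoc]
  field_simp
  ring

theorem weight_mono {τ τ' : ℝ} (hτ : 0 ≤ τ) (h : τ ≤ τ') : weight τ ≤ weight τ' := by
  have h1 := weight_add_sub hτ (sub_nonneg.2 h)
  have h2 : 0 ≤ (τ' - τ) / ((1 + τ) * (1 + τ + (τ' - τ))) := by
    have := sub_nonneg.2 h
    positivity
  rw [add_sub_cancel] at h1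
  linarith

theorem weight_add_le {τ h : ℝ} (hτ : 0 ≤ τ) (hh : 0 ≤ h) : weight (τ + h) ≤ weight τ + h := by
  have h1 := weight_add_sub hτ hh
  have h2 : h / ((1 + τ) * (1 + τ + h)) ≤ h := div_le_self hh (by nlinarith)
  linarith

theorem one_le_weight {τ : ℝ} (hτ : 0 ≤ τ) : 1 ≤ weight τ := weight_zero ▸ weight_mono le_rfl hτ

theorem weight_le_two {τ : ℝ} (hτ : 0 ≤ τ) : weight τ ≤ 2 := by
  have : 0 ≤ 1 / (1 + τ) := by positivity
  rw [weight]
  linarith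

/-- A Lipschitz function of `b` that equals `b` for `2 * c ≤ b` and vanishes for `b ≤ c`. -/
def gate (b c : ℝ) : ℝ := min b (2 * max (b - c) 0)

theorem gate_nonneg {b : ℝ} (hb : 0 ≤ b) (c : ℝ) : 0 ≤ gate b c :=
  le_min hb (mul_nonneg zero_le_two (le_max_right _ _))

theorem gate_le (b c : ℝ) : gate b c ≤ b := min_le_left _ _

theorem gate_anti {b c c' : ℝ} (h : c ≤ c') : gate b c' ≤ gate b c := by
  unfold gate
  gcongr

theorem gate_eq_self {b c : ℝ} (h : 2 * c ≤ b) : gate b c = b :=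
  min_eq_left (by linarith [le_max_left (b - c) 0])

theorem gate_eq_zero {b c : ℝ} (hb : 0 ≤ b) (h : b ≤ c) : gate b c = 0 := by
  rw [gate, max_eq_right (by linarith), mul_zero, min_eq_right hb]

theorem gate_le_add (b b' c : ℝ) : gate b c ≤ gate b' c + 2 * |b - b'| := by
  have h1 := le_abs_self (b - b')
  have h2 := abs_nonneg (b - b')
  have h3 : max (b - c) 0 ≤ max (b' - c) 0 + |b - b'| :=
    max_le (by linarith [le_max_left (b' - c) 0]) (by linarith [le_max_right (b' - c) 0])
  unfold gate
  rw [← min_add_add_right]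
  refine le_min ((min_le_left _ _).trans (by linarith)) ((min_le_right _ _).trans (by linarith))

/-- A continuous positive definite decay rate adapted to a class `𝒦ℒ` function. -/
theorem ClassKL.exists_rate {β : ℝ → ℝ → ℝ} (h : ClassKL β) :
    ∃ φ, ClassP φ ∧ ∀ r τ, 0 ≤ r → 0 ≤ τ → (τ = 0 ∨ r ≤ 8 * β (2 * r) τ) →
      φ r ≤ r / (4 * ((1 + τ) * (2 + τ))) := by
  set A : Set (ℝ × ℝ) := {p | 0 ≤ p.1 ∧ 0 ≤ p.2 ∧ (p.2 = 0 ∨ p.1 ≤ 8 * β (2 * p.1) p.2)} with hA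
  -- The infimum over `A` is an inf-convolution with the absolute value, hence 1-Lipschitz. The
  -- pairs with `τ = 0` make it vanish at `0` and give `φ r ≤ r / 8`.
  set F : ℝ → A → ℝ := fun r p => p.1.1 / (4 * ((1 + p.1.2) * (2 + p.1.2))) + |r - p.1.1| with hF
  have hne : Nonempty A := ⟨⟨(0, 0), le_rfl, le_rfl, Or.inl rfl⟩⟩
  have hF0 : ∀ r p, 0 ≤ F r p := fun r p => by
    have h1 := p.2.1
    have h2 := p.2.2.1
    simp only [hF]
    positivity
  have hbdd : ∀ r, BddBelow (range (F r)) := fun r => ⟨0, by rintro _ ⟨p, rfl⟩; exact hF0 r p⟩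
  have hval : ∀ r τ, 0 ≤ r → 0 ≤ τ → (τ = 0 ∨ r ≤ 8 * β (2 * r) τ) →
      ⨅ p, F r p ≤ r / (4 * ((1 + τ) * (2 + τ))) := by
    intro r τ hr hτ hrτ
    refine (ciInf_le (hbdd r) ⟨(r, τ), hr, hτ, hrτ⟩).trans (le_of_eq ?_)
    simp [hF]
  refine ⟨fun r => ⨅ p, F r p, ⟨?_, ?_, ?_⟩, hval⟩
  · have hlip : LipschitzWith 1 fun r => ⨅ p, F r p := by
      refine LipschitzWith.of_le_add fun r r' => ?_
      rw [← sub_le_iff_le_add]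
      refine le_ciInf fun p => ?_
      rw [sub_le_iff_le_add]
      refine (ciInf_le (hbdd r) p).trans ?_
      have := abs_sub_le r r' p.1.1
      simp only [hF, Real.dist_eq]
      linarith
    exact hlip.continuous.continuousOn
  · refine le_antisymm ?_ (le_ciInf fun p => hF0 0 p)
    simpa using hval 0 0 le_rfl le_rfl (Or.inl rfl)
  · intro r hr
    -- For `|r - s| < r / 2`, a pair in `A` with `τ > T` would give `s ≤ 8 * β (3 * r) τ < r / 2 <
    -- s`. So either `s` is far from `r` or `τ ≤ T`, and the infimum is positive.
    obtain ⟨T, hT0, hT⟩ := h.exists_forall_le (r := 3 * r) (ε := r / 16) (by positivity)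
      (by positivity)
    refine lt_of_lt_of_le (lt_min (show 0 < r / 2 / (4 * ((1 + T) * (2 + T))) by positivity)
      (half_pos hr)) (le_ciInf fun p => ?_)
    obtain ⟨⟨s, τ⟩, hs, hτ, hsτ⟩ := p
    simp only [hF]
    dsimp only at hs hτ hsτ ⊢
    rcases le_or_gt (r / 2) |r - s| with hfar | hnear
    · refine (min_le_right _ _).trans (hfar.trans (le_add_of_nonneg_left ?_))
      positivity
    · rw [abs_lt] at hnear
      have hτT : τ ≤ T := by
        rcases hsτ with rfl | hsτ
        · exact hT0
        by_contra hlt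
        push Not at hlt
        have h1 := hT τ hlt.le
        have h2 : β (2 * s) τ ≤ β (3 * r) τ := h.mono (by positivity) (by linarith) hτ
        linarith
      refine (min_le_left _ _).trans (le_add_of_le_of_nonneg ?_ (abs_nonneg _))
      gcongr
      linarith

/-! ### The Lyapunov function and its bounds. -/

namespace ImpulsiveSwitchedSystem

variable {n m : ℕ} {M : Type*} {sys : ImpulsiveSwitchedSystem n m M}

/-- The weighted norm of the state at time `t + τ` on the curve `z`, discounted if it is small
compared with the input. -/
def payoff (sys : ImpulsiveSwitchedSystem n m M) (γ : ℝ → ℝ) (u : ℝ → EuclideanSpace ℝ (Fin m))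
    (z : ℝ → EuclideanSpace ℝ (Fin n)) (t τ : ℝ) : ℝ :=
  weight τ * gate ‖z (t + τ)‖ (2 * γ (sys.inputNorm u))

/-- The converse Lyapunov function: the supremum of the norm and of all payoffs of solutions. -/
def lyapunov (sys : ImpulsiveSwitchedSystem n m M) (γ : ℝ → ℝ) (t : ℝ)
    (x : EuclideanSpace ℝ (Fin n)) : ℝ :=
  sSup (insert ‖x‖ {a | ∃ u z τ, sys.IsInput u ∧ sys.IsSolution u t x z ∧ 0 ≤ τ ∧
    a = sys.payoff γ u z t τ})

variable {β : ℝ → ℝ → ℝ} {γ : ℝ → ℝ} {s t t' τ : ℝ} {x₀ : EuclideanSpace ℝ (Fin n)}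
  {x z : ℝ → EuclideanSpace ℝ (Fin n)} {u v : ℝ → EuclideanSpace ℝ (Fin m)}

theorem payoff_nonneg (γ : ℝ → ℝ) (u : ℝ → EuclideanSpace ℝ (Fin m))
    (z : ℝ → EuclideanSpace ℝ (Fin n)) (t : ℝ) (hτ : 0 ≤ τ) : 0 ≤ sys.payoff γ u z t τ :=
  mul_nonneg (zero_le_one.trans (one_le_weight hτ)) (gate_nonneg (norm_nonneg _) _)

theorem payoff_le_two_mul (γ : ℝ → ℝ) (u : ℝ → EuclideanSpace ℝ (Fin m))
    (z : ℝ → EuclideanSpace ℝ (Fin n)) (t : ℝ) (hτ : 0 ≤ τ) :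
    sys.payoff γ u z t τ ≤ 2 * ‖z (t + τ)‖ :=
  mul_le_mul (weight_le_two hτ) (gate_le _ _) (gate_nonneg (norm_nonneg _) _) zero_le_two

/-- The system is robustly forward complete and input-to-state stable with gains `β` and `γ`. -/
structure IsISSWith (sys : ImpulsiveSwitchedSystem n m M) (β : ℝ → ℝ → ℝ) (γ : ℝ → ℝ) : Prop where
  complete : sys.IsRobustlyForwardComplete
  classKL : ClassKL β
  classKInf : ClassKInf γ
  estimate : sys.HasISSEstimate β γ

namespace IsISSWith

theorem gain_nonneg (H : sys.IsISSWith β γ) (u : ℝ → EuclideanSpace ℝ (Fin m)) :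
    0 ≤ γ (sys.inputNorm u) :=
  H.classKInf.nonneg (inputNorm_nonneg u)

theorem norm_le (H : sys.IsISSWith β γ) (ht : sys.t₀ ≤ t) (hu : sys.IsInput u)
    (hz : sys.IsSolution u t x₀ z) (hτ : 0 ≤ τ) :
    ‖z (t + τ)‖ ≤ β ‖x₀‖ τ + γ (sys.inputNorm u) := by
  have h1 := hz.norm_le H.complete H.estimate ht hu (t := t + τ) (by linarith)
  rwa [add_sub_cancel_left] at h1

/-- Where the gate is open, the gain is less than half of the norm, so it can be absorbed in the ISS
estimate. -/
theorem gate_le (H : sys.IsISSWith β γ) (ht : sys.t₀ ≤ t) (hu : sys.IsInput u)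
    (hz : sys.IsSolution u t x₀ z) (hτ : 0 ≤ τ) :
    gate ‖z (t + τ)‖ (2 * γ (sys.inputNorm u)) ≤ 2 * β ‖x₀‖ τ := by
  have h1 := H.norm_le ht hu hz hτ
  rcases le_or_gt ‖z (t + τ)‖ (2 * γ (sys.inputNorm u)) with h | h
  · rw [gate_eq_zero (norm_nonneg _) h]
    exact mul_nonneg zero_le_two (H.classKL.nonneg (norm_nonneg _) hτ)
  · exact (ISS.gate_le _ _).trans (by linarith)

theorem payoff_le (H : sys.IsISSWith β γ) (ht : sys.t₀ ≤ t) (hu : sys.IsInput u)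
    (hz : sys.IsSolution u t x₀ z) (hτ : 0 ≤ τ) : sys.payoff γ u z t τ ≤ 4 * β ‖x₀‖ τ := by
  have h1 := mul_le_mul (weight_le_two hτ) (H.gate_le ht hu hz hτ)
    (gate_nonneg (norm_nonneg _) _) zero_le_two
  rw [payoff]
  linarith

theorem payoff_le_zero_time (H : sys.IsISSWith β γ) (ht : sys.t₀ ≤ t) (hu : sys.IsInput u)
    (hz : sys.IsSolution u t x₀ z) (hτ : 0 ≤ τ) :
    sys.payoff γ u z t τ ≤ ‖x₀‖ + 4 * β ‖x₀‖ 0 := by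
  have h1 := H.payoff_le ht hu hz hτ
  have h2 := H.classKL.anti (norm_nonneg x₀) le_rfl hτ
  linarith [norm_nonneg x₀]

theorem bddAbove (H : sys.IsISSWith β γ) (ht : sys.t₀ ≤ t) (x₀ : EuclideanSpace ℝ (Fin n)) :
    BddAbove (insert ‖x₀‖ {a | ∃ u z τ, sys.IsInput u ∧ sys.IsSolution u t x₀ z ∧ 0 ≤ τ ∧
      a = sys.payoff γ u z t τ}) := by
  refine ⟨‖x₀‖ + 4 * β ‖x₀‖ 0, ?_⟩
  rintro a (rfl | ⟨u, z, τ, hu, hz, hτ, rfl⟩)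
  · linarith [H.classKL.nonneg (norm_nonneg x₀) le_rfl]
  · exact H.payoff_le_zero_time ht hu hz hτ

theorem norm_le_lyapunov (H : sys.IsISSWith β γ) (ht : sys.t₀ ≤ t)
    (x₀ : EuclideanSpace ℝ (Fin n)) : ‖x₀‖ ≤ sys.lyapunov γ t x₀ :=
  le_csSup (H.bddAbove ht x₀) (mem_insert _ _)

theorem payoff_le_lyapunov (H : sys.IsISSWith β γ) (ht : sys.t₀ ≤ t) (hu : sys.IsInput u)
    (hz : sys.IsSolution u t x₀ z) (hτ : 0 ≤ τ) : sys.payoff γ u z t τ ≤ sys.lyapunov γ t x₀ :=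
  le_csSup (H.bddAbove ht x₀) (mem_insert_of_mem _ ⟨u, z, τ, hu, hz, hτ, rfl⟩)

end IsISSWith

theorem lyapunov_le (sys : ImpulsiveSwitchedSystem n m M) {b : ℝ} (hb : ‖x₀‖ ≤ b)
    (h : ∀ u z τ, sys.IsInput u → sys.IsSolution u t x₀ z → 0 ≤ τ → sys.payoff γ u z t τ ≤ b) :
    sys.lyapunov γ t x₀ ≤ b := by
  refine csSup_le (insert_nonempty _ _) ?_
  rintro a (rfl | ⟨u, z, τ, hu, hz, hτ, rfl⟩)
  · exact hb
  · exact h u z τ hu hz hτ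

namespace IsISSWith

theorem lyapunov_le_bound (H : sys.IsISSWith β γ) (ht : sys.t₀ ≤ t)
    (x₀ : EuclideanSpace ℝ (Fin n)) : sys.lyapunov γ t x₀ ≤ ‖x₀‖ + 4 * β ‖x₀‖ 0 :=
  sys.lyapunov_le (by linarith [H.classKL.nonneg (norm_nonneg x₀) le_rfl])
    fun _ _ _ hu hz hτ => H.payoff_le_zero_time ht hu hz hτ

/-! ### Decay along solutions. -/

/-- Payoffs reached from a later point of a solution are reached, with a larger weight, from the
earlier points, if they are large compared with the input of the solution. -/
theorem weight_mul_gate_le_lyapunov (H : sys.IsISSWith β γ) (hs : sys.t₀ ≤ s) (hu : sys.IsInput u)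
    (hx : sys.IsSolution u s x₀ x) (hst : s ≤ t) {h : ℝ} (hh : 0 ≤ h) (hv : sys.IsInput v)
    (hz : sys.IsSolution v (t + h) (x (t + h)) z) (hτ : 0 ≤ τ)
    (hlarge : 2 * (2 * γ (sys.inputNorm u)) ≤ ‖z (t + h + τ)‖) :
    weight (τ + h) * gate ‖z (t + h + τ)‖ (2 * γ (sys.inputNorm v)) ≤ sys.lyapunov γ t (x t) := by
  obtain ⟨y, hy, -, hyz⟩ := H.complete.exists_concat (hs.trans hst) hu hv
    (show t ≤ t + h by linarith) (hx.restrict hst) hz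
  have h1 := H.payoff_le_lyapunov (hs.trans hst) (hu.concat hv _) hy (show 0 ≤ τ + h by linarith)
  refine le_trans ?_ h1
  rw [payoff, show t + (τ + h) = t + h + τ by ring, hyz _ (by linarith)]
  refine mul_le_mul_of_nonneg_left ?_ (zero_le_one.trans (one_le_weight (by linarith)))
  have h2 := hu.inputNorm_concat_le hv (t + h)
  have h3 := sys.inputNorm_nonneg (concat u v (t + h))
  -- If `v` dominates, the gate threshold does not rise. If `u` dominates it may rise, but by
  -- `hlarge` the state is above twice the new threshold and the gate is fully open.
  rcases le_total (sys.inputNorm u) (sys.inputNorm v) with h4 | h4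
  · rw [max_eq_right h4] at h2
    exact gate_anti (mul_le_mul_of_nonneg_left (H.classKInf.mono h3 h2) zero_le_two)
  · rw [max_eq_left h4] at h2
    have h5 := H.classKInf.mono h3 h2
    rw [gate_eq_self (b := ‖z (t + h + τ)‖)
      (c := 2 * γ (sys.inputNorm (concat u v (t + h)))) (by linarith)]
    exact ISS.gate_le _ _

/-- Along a solution, the Lyapunov function decreases while it is large compared with the
input. -/
theorem lyapunov_le_max (H : sys.IsISSWith β γ) (hs : sys.t₀ ≤ s) (hu : sys.IsInput u)
    (hx : sys.IsSolution u s x₀ x) (hst : s ≤ t) (htt' : t ≤ t') :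
    sys.lyapunov γ t' (x t') ≤ max (sys.lyapunov γ t (x t)) (8 * γ (sys.inputNorm u)) := by
  obtain ⟨h, hh, rfl⟩ : ∃ h, 0 ≤ h ∧ t' = t + h := ⟨t' - t, by linarith, by ring⟩
  have hu0 := H.gain_nonneg u
  have key : ∀ v z τ, sys.IsInput v → sys.IsSolution v (t + h) (x (t + h)) z → 0 ≤ τ →
      weight τ * gate ‖z (t + h + τ)‖ (2 * γ (sys.inputNorm v)) ≤
        max (sys.lyapunov γ t (x t)) (8 * γ (sys.inputNorm u)) := by
    intro v z τ hv hz hτ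
    have hg0 := gate_nonneg (norm_nonneg (z (t + h + τ))) (2 * γ (sys.inputNorm v))
    -- States below `4 * γ` have payoff at most `8 * γ`, as the weight is at most `2`.
    rcases le_or_gt (2 * (2 * γ (sys.inputNorm u))) ‖z (t + h + τ)‖ with hl | hl
    · refine le_trans ?_ ((H.weight_mul_gate_le_lyapunov hs hu hx hst hh hv hz hτ hl).trans
        (le_max_left _ _))
      exact mul_le_mul_of_nonneg_right (weight_mono hτ (by linarith)) hg0
    · refine le_trans ?_ (le_max_right _ _)
      refine (payoff_le_two_mul (sys := sys) γ v z (t + h) hτ).trans ?_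
      linarith
  refine sys.lyapunov_le ?_ key
  rcases le_or_gt (2 * (2 * γ (sys.inputNorm u))) ‖x (t + h)‖ with hl | hl
  · have := key u x 0 hu (hx.restrict (hst.trans htt')) le_rfl
    rwa [add_zero, weight_zero, one_mul, gate_eq_self hl] at this
  · exact le_trans (by linarith) (le_max_right _ _)

/-- The decay of the Lyapunov function along solutions, in quantitative form. -/
theorem lyapunov_add_le (H : sys.IsISSWith β γ) {φ : ℝ → ℝ}
    (hφ : ∀ r τ, 0 ≤ r → 0 ≤ τ → (τ = 0 ∨ r ≤ 8 * β (2 * r) τ) →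
      φ r ≤ r / (4 * ((1 + τ) * (2 + τ)))) (hs : sys.t₀ ≤ s) (hu : sys.IsInput u)
    (hx : sys.IsSolution u s x₀ x) (hst : s ≤ t)
    (hW : 16 * γ (sys.inputNorm u) ≤ sys.lyapunov γ t (x t)) {h : ℝ} (hh : 0 ≤ h) (hh1 : h ≤ 1)
    (hnear : ‖x (t + h)‖ ≤ 2 * ‖x t‖) :
    sys.lyapunov γ (t + h) (x (t + h)) ≤
      sys.lyapunov γ t (x t) - h * φ (sys.lyapunov γ t (x t)) := by
  set W := sys.lyapunov γ t (x t) with hWdef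
  have hu0 := H.gain_nonneg u
  have ht : sys.t₀ ≤ t := hs.trans hst
  have hxW : ‖x t‖ ≤ W := H.norm_le_lyapunov ht _
  have hW0 : 0 ≤ W := (norm_nonneg _).trans hxW
  -- Since `φ W ≤ W / 8` and `h ≤ 1`, payoffs up to `W / 2` are harmless.
  have hhalf : W / 2 ≤ W - h * φ W := by
    have h1 := hφ W 0 hW0 le_rfl (Or.inl rfl)
    have h2 : h * φ W ≤ h * (W / (4 * ((1 + 0) * (2 + 0)))) := mul_le_mul_of_nonneg_left h1 hh
    nlinarith
  have key : ∀ v z τ, sys.IsInput v → sys.IsSolution v (t + h) (x (t + h)) z → 0 ≤ τ →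
      (τ = 0 ∨ sys.payoff γ v z (t + h) τ ≤ 4 * β ‖x (t + h)‖ τ) →
      sys.payoff γ v z (t + h) τ ≤ W - h * φ W := by
    intro v z τ hv hz hτ hpay
    rcases le_or_gt (sys.payoff γ v z (t + h) τ) (W / 2) with hsmall | hbig
    · exact hsmall.trans hhalf
    -- A payoff above `W / 2` forces `W ≤ 8 * β (2 * W) τ`, or `τ = 0`, which is where the rate
    -- applies. It also forces a state norm above `W / 4 ≥ 4 * γ`, so the concatenation lemma
    -- applies.
    have hβ : β ‖x (t + h)‖ τ ≤ β (2 * W) τ :=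
      H.classKL.mono (norm_nonneg _) (by linarith) hτ
    have hrate := hφ W τ hW0 hτ (hpay.imp_right fun hpay => by linarith)
    have hb := payoff_le_two_mul (sys := sys) γ v z (t + h) hτ
    have h1 := H.weight_mul_gate_le_lyapunov hs hu hx hst hh hv hz hτ (by linarith)
    rw [payoff] at hbig ⊢
    set g := gate ‖z (t + h + τ)‖ (2 * γ (sys.inputNorm v))
    have hg0 : 0 ≤ g := gate_nonneg (norm_nonneg _) _
    have hg : W / 4 ≤ g := by
      have := mul_le_mul_of_nonneg_right (weight_le_two hτ) hg0
      linarith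
    have h2 := weight_add_sub hτ hh
    have h3 : h * φ W ≤ (weight (τ + h) - weight τ) * g := by
      calc h * φ W ≤ h * (W / (4 * ((1 + τ) * (2 + τ)))) := mul_le_mul_of_nonneg_left hrate hh
        _ = h / ((1 + τ) * (2 + τ)) * (W / 4) := by field_simp
        _ ≤ h / ((1 + τ) * (1 + τ + h)) * g := by
            have : (1 + τ) * (1 + τ + h) ≤ (1 + τ) * (2 + τ) :=
              mul_le_mul_of_nonneg_left (by linarith) (by linarith)
            gcongr
        _ = _ := by rw [h2]
    linarith
  refine sys.lyapunov_le ?_ fun v z τ hv hz hτ =>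
    key v z τ hv hz hτ (Or.inr (H.payoff_le (by linarith) hv hz hτ))
  rcases le_or_gt (2 * (2 * γ (sys.inputNorm u))) ‖x (t + h)‖ with hl | hl
  · have := key u x 0 hu (hx.restrict (by linarith)) le_rfl (Or.inl rfl)
    rwa [payoff, add_zero, weight_zero, one_mul, gate_eq_self hl] at this
  · exact le_trans (by linarith) hhalf

theorem upperDini_lyapunov_le (H : sys.IsISSWith β γ) {φ : ℝ → ℝ} (hφP : ClassP φ)
    (hφ : ∀ r τ, 0 ≤ r → 0 ≤ τ → (τ = 0 ∨ r ≤ 8 * β (2 * r) τ) →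
      φ r ≤ r / (4 * ((1 + τ) * (2 + τ)))) (hs : sys.t₀ ≤ s) (hu : sys.IsInput u)
    (hx : sys.IsSolution u s x₀ x) (hst : s ≤ t)
    (hW : 16 * γ (sys.inputNorm u) ≤ sys.lyapunov γ t (x t)) :
    upperDini (fun r => sys.lyapunov γ r (x r)) t ≤
      ((-φ (sys.lyapunov γ t (x t)) : ℝ) : EReal) := by
  have hu0 := H.gain_nonneg u
  suffices hev : ∀ᶠ h : ℝ in 𝓝[>] 0, sys.lyapunov γ (t + h) (x (t + h)) ≤
      sys.lyapunov γ t (x t) - h * φ (sys.lyapunov γ t (x t)) by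
    refine limsup_le_of_le (by isBoundedDefault) ?_
    filter_upwards [hev, self_mem_nhdsWithin] with h hh h0
    have h0 : 0 < h := h0
    rw [EReal.coe_le_coe_iff, div_le_iff₀ h0]
    linarith
  have ht : sys.t₀ ≤ t := hs.trans hst
  have hxW := H.norm_le_lyapunov ht (x t)
  -- At the zero state continuity does not give `‖x (t + h)‖ ≤ 2 * ‖x t‖`. There `W = 0`, so `hW`
  -- forces the gain to vanish and `W` stays `0`.
  rcases (norm_nonneg (x t)).eq_or_lt with hx0 | hx0
  · have hW0 : sys.lyapunov γ t (x t) = 0 := by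
      refine le_antisymm ?_ ((norm_nonneg _).trans hxW)
      have := H.lyapunov_le_bound ht (x t)
      rwa [← hx0, (H.classKL.classK 0 le_rfl).map_zero, mul_zero, add_zero] at this
    filter_upwards [self_mem_nhdsWithin] with h hh
    have hh : 0 < h := hh
    have := H.lyapunov_le_max hs hu hx hst (show t ≤ t + h by linarith)
    rw [hW0] at this hW ⊢
    rw [hφP.map_zero, mul_zero, sub_zero]
    exact this.trans (max_le le_rfl (by linarith))
  · have hlim : Tendsto (fun h : ℝ => ‖x (t + h)‖) (𝓝[>] 0) (𝓝 ‖x t‖) := by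
      refine ((hx.rightCont t hst).tendsto.comp (tendsto_nhdsWithin_iff.2 ⟨?_, ?_⟩)).norm
      · exact ((show Continuous fun h : ℝ => t + h by fun_prop).tendsto' 0 t (by simp)).mono_left
          nhdsWithin_le_nhds
      · filter_upwards [self_mem_nhdsWithin] with h hh
        have hh : 0 < h := hh
        exact mem_Ici.2 (by linarith)
    filter_upwards [hlim.eventually (Iio_mem_nhds (show ‖x t‖ < 2 * ‖x t‖ by linarith)),
      Ioc_mem_nhdsGT (zero_lt_one (α := ℝ))] with h h1 h2
    exact H.lyapunov_add_le hφ hs hu hx hst hW h2.1.le h2.2 (le_of_lt h1)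

/-! ### Piecewise continuity of the Lyapunov function. -/

/-- Inputs with a large norm have no payoff for initial states from a ball. -/
theorem exists_payoff_eq_zero (H : sys.IsISSWith β γ) (R : ℝ) :
    ∃ D, ∀ t u x₀ z τ, sys.t₀ ≤ t → sys.IsInput u → sys.IsSolution u t x₀ z → 0 ≤ τ → ‖x₀‖ ≤ R →
      D < sys.inputNorm u → sys.payoff γ u z t τ = 0 := by
  obtain ⟨D, hD⟩ := eventually_atTop.1
    (H.classKInf.tendsto_atTop.eventually_ge_atTop (β R 0))
  refine ⟨D, fun t u x₀ z τ ht hu hz hτ hR huD => ?_⟩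
  have h1 := H.norm_le ht hu hz hτ
  have h2 := H.classKL.anti (norm_nonneg x₀) le_rfl hτ
  have h3 := H.classKL.mono (norm_nonneg x₀) hR le_rfl
  have h4 := hD _ huD.le
  rw [payoff, gate_eq_zero (norm_nonneg _) (by linarith), mul_zero]

/-- Payoffs depend on the initial state in a Lipschitz way, up to an arbitrarily small error. -/
theorem exists_payoff_le_add (H : sys.IsISSWith β γ) (i : ℕ) {R ε : ℝ} (hR : 0 ≤ R)
    (hε : 0 < ε) :
    ∃ C, 0 ≤ C ∧ ∀ t u x₀ y₀ x y τ, sys.t₀ ≤ t → t ≤ sys.σ.time i → sys.IsInput u →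
      sys.IsSolution u t x₀ x → sys.IsSolution u t y₀ y → 0 ≤ τ → ‖x₀‖ ≤ R → ‖y₀‖ ≤ R →
      sys.payoff γ u x t τ ≤ sys.payoff γ u y t τ + (ε + C * ‖x₀ - y₀‖) := by
  obtain ⟨D, hD⟩ := H.exists_payoff_eq_zero R
  obtain ⟨T, -, hT⟩ := H.classKL.exists_forall_le hR (show 0 < ε / 4 by positivity)
  obtain ⟨j, hj⟩ := sys.σ.exists_le_time (sys.σ.time i + T)
  obtain ⟨C, hC1, hC⟩ := sys.exists_lipschitz_initial (β R 0 + γ D) D j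
  -- The weight is at most `2` and the gate is 2-Lipschitz. Large inputs have no payoff, and beyond
  -- time `T` payoffs are below `ε`, so `C` is needed on a bounded time interval only.
  refine ⟨4 * C, by linarith, fun t u x₀ y₀ x y τ ht hti hu hx hy hτ hxR hyR => ?_⟩
  have hy0 := payoff_nonneg (sys := sys) γ u y t hτ
  have hd0 : 0 ≤ 4 * C * ‖x₀ - y₀‖ := by positivity
  rcases lt_or_ge D (sys.inputNorm u) with huD | huD
  · rw [hD t u x₀ x τ ht hu hx hτ hxR huD]
    linarith
  rcases le_or_gt T τ with hTτ | hTτ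
  · have h1 := H.payoff_le ht hu hx hτ
    have h2 := H.classKL.mono (norm_nonneg x₀) hxR hτ
    linarith [hT τ hTτ]
  have hK : ∀ {w w₀}, sys.IsSolution u t w₀ w → ‖w₀‖ ≤ R → ∀ q, t ≤ q → ‖w q‖ ≤ β R 0 + γ D :=
    fun hw hwR q hq => hw.norm_le_of_le H.complete H.estimate H.classKL H.classKInf.toClassK ht hu
      hwR huD hq
  have h1 := hC t (t + τ) ht u u hu huD (fun _ _ => rfl) x₀ y₀ x y hx hy
    (fun q hq => ⟨hK hx hxR q hq.1, hK hy hyR q hq.1⟩) (t + τ) ⟨by linarith, le_rfl⟩ (by linarith)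
  have h2 := gate_le_add ‖x (t + τ)‖ ‖y (t + τ)‖ (2 * γ (sys.inputNorm u))
  have h3 := abs_norm_sub_norm_le (x (t + τ)) (y (t + τ))
  rw [payoff, payoff]
  have h4 := mul_le_mul_of_nonneg_left h2 (zero_le_one.trans (one_le_weight hτ))
  have h5 : weight τ * (2 * |‖x (t + τ)‖ - ‖y (t + τ)‖|) ≤ 2 * (2 * (C * ‖x₀ - y₀‖)) :=
    mul_le_mul (weight_le_two hτ) (by linarith) (by positivity) zero_le_two
  linarith

/-- The Lyapunov function varies little over short times, as long as displacements are small. -/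
theorem exists_abs_lyapunov_sub_le (H : sys.IsISSWith β γ) (i : ℕ) {R ε : ℝ} (hR : 0 ≤ R)
    (hε : 0 < ε) :
    ∃ K D η, 0 < η ∧ ∀ t t', sys.σ.time i ≤ t → t ≤ t' → t' < sys.σ.time (i + 1) → t' ≤ t + η →
      ∀ x₀ ∈ sys.X, ∀ y₀ ∈ sys.X, ‖x₀‖ ≤ R → ‖y₀‖ ≤ R → ‖x₀ - y₀‖ ≤ η →
      (∀ q ∈ Icc t t', sys.SmallDisplacement K D η t q) →
      |sys.lyapunov γ t x₀ - sys.lyapunov γ t' y₀| ≤ ε := by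
  have hR' : 0 ≤ R + 1 := by linarith
  obtain ⟨D, hD⟩ := H.exists_payoff_eq_zero (R + 1)
  obtain ⟨C, hC0, hC⟩ := H.exists_payoff_le_add (i + 1) hR' (half_pos hε)
  set B := β (R + 1) 0 with hB
  have hB0 : 0 ≤ B := H.classKL.nonneg hR' le_rfl
  -- Sum of the coefficients of `η` below: `2 * C` from states at distance `2 * η`, `2 * B` from the
  -- shift of the weight, `R + 3` from payoffs attained before `t'`.
  set Q := 2 * C + 2 * B + R + 3 with hQ
  have hQ0 : 0 < Q := by positivity
  set η := min 1 (ε / 2 / Q) with hηdef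
  have hη0 : 0 < η := lt_min one_pos (by positivity)
  have hη1 : η ≤ 1 := min_le_left _ _
  have hηQ : η * Q ≤ ε / 2 := (le_div_iff₀ hQ0).1 (min_le_right _ _)
  have e1 : 0 ≤ η * C := by positivity
  have e2 : 0 ≤ η * B := by positivity
  have e3 : 0 ≤ η * R := by positivity
  have hηQ' : 2 * (η * C) + 2 * (η * B) + η * R + 3 * η ≤ ε / 2 := by
    rw [hQ] at hηQ
    linarith
  refine ⟨B + γ D, D, η, hη0, fun t t' hit htt' ht'i htη x₀ hx₀ y₀ hy₀ hxR hyR hxy hsmall => ?_⟩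
  have ht : sys.t₀ ≤ t := (sys.σ.t₀_le_time i).trans hit
  have ht' : sys.t₀ ≤ t' := ht.trans htt'
  have hnxy : |‖x₀‖ - ‖y₀‖| ≤ η := (abs_norm_sub_norm_le _ _).trans hxy
  rw [abs_le] at hnxy
  have hxW := H.norm_le_lyapunov ht x₀
  have hyW := H.norm_le_lyapunov ht' y₀
  have hx0 := norm_nonneg x₀
  have hy0 := norm_nonneg y₀
  have hdisp : ∀ u z, sys.IsInput u → sys.inputNorm u ≤ D → sys.IsSolution u t x₀ z →
      ∀ q ∈ Icc t t', ‖z q - x₀‖ ≤ η := by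
    intro u z hu huD hz q hq
    have h1 := hsmall q hq u hu huD z (hz.isFlow le_rfl hit (hq.2.trans_lt ht'i)) fun p hp =>
      hz.norm_le_of_le H.complete H.estimate H.classKL H.classKInf.toClassK ht hu
        (hxR.trans (by linarith)) huD hp.1
    rwa [hz.init] at h1
  have hz' : ∀ {z : EuclideanSpace ℝ (Fin n)}, ‖z - x₀‖ ≤ η →
      ‖z‖ ≤ ‖x₀‖ + η ∧ ‖z - y₀‖ ≤ 2 * η := by
    intro z hz
    have h1 := norm_sub_norm_le z x₀
    have h2 := norm_sub_le_norm_sub_add_norm_sub z x₀ y₀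
    constructor <;> linarith
  rw [abs_sub_le_iff]
  constructor
  · rw [sub_le_iff_le_add']
    refine sys.lyapunov_le (by linarith) fun u z τ hu hz hτ => ?_
    rcases lt_or_ge D (sys.inputNorm u) with huD | huD
    · rw [hD t u x₀ z τ ht hu hz hτ (by linarith) huD]
      linarith
    rcases le_or_gt (t' - t) τ with hτt | hτt
    · obtain ⟨τ', hτ', rfl⟩ : ∃ τ', 0 ≤ τ' ∧ τ = τ' + (t' - t) :=
        ⟨τ - (t' - t), by linarith, by ring⟩
      obtain ⟨y, hy⟩ := (H.complete t' ht').1 y₀ hy₀ u hu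
      obtain ⟨h1, h2⟩ := hz' (hdisp u z hu huD hz t' ⟨htt', le_rfl⟩)
      have hz1 := hz.restrict htt'
      have h3 := hC t' u _ y₀ z y τ' ht' ht'i.le hu hz1 hy hτ' (by linarith) (by linarith)
      have h4 := H.payoff_le_lyapunov ht' hu hy hτ'
      have h5 : C * ‖z t' - y₀‖ ≤ C * (2 * η) := mul_le_mul_of_nonneg_left h2 hC0
      have h6 : sys.payoff γ u z t (τ' + (t' - t)) ≤ sys.payoff γ u z t' τ' + η * (2 * B) := by
        have h7 := H.gate_le ht' hu hz1 hτ'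
        have h8 := H.classKL.anti (norm_nonneg (z t')) le_rfl hτ'
        have h9 := H.classKL.mono (norm_nonneg (z t')) (show ‖z t'‖ ≤ R + 1 by linarith) le_rfl
        have h10 := gate_nonneg (norm_nonneg (z (t' + τ'))) (2 * γ (sys.inputNorm u))
        rw [payoff, payoff, show t + (τ' + (t' - t)) = t' + τ' by ring]
        have h11 := mul_le_mul_of_nonneg_right (weight_add_le hτ' (sub_nonneg.2 htt')) h10
        have h12 : (t' - t) * gate ‖z (t' + τ')‖ (2 * γ (sys.inputNorm u)) ≤ η * (2 * B) :=
          mul_le_mul (by linarith) (by linarith) h10 hη0.le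
        linarith
      linarith
    -- A payoff attained before `t'` is not available from `t'`. It is close to at most `‖x₀‖`, and
    -- is compared with the term `‖y₀‖` of the supremum.
    · obtain ⟨h1, -⟩ := hz' (hdisp u z hu huD hz (t + τ) ⟨by linarith, by linarith⟩)
      have h2 : weight τ ≤ 1 + η := by
        have := weight_add_le le_rfl hτ
        rw [zero_add, weight_zero] at this
        linarith
      have h3 : sys.payoff γ u z t τ ≤ (1 + η) * (‖x₀‖ + η) :=
        mul_le_mul h2 ((ISS.gate_le _ _).trans h1) (gate_nonneg (norm_nonneg _) _) (by linarith)
      have h4 : η * (‖x₀‖ + η) ≤ η * (R + 1) :=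
        mul_le_mul_of_nonneg_left (by linarith) hη0.le
      linarith
  · rw [sub_le_iff_le_add']
    refine sys.lyapunov_le (by linarith) fun u y τ hu hy hτ => ?_
    rcases lt_or_ge D (sys.inputNorm u) with huD | huD
    · rw [hD t' u y₀ y τ ht' hu hy hτ (by linarith) huD]
      linarith
    obtain ⟨z, hz⟩ := (H.complete t ht).1 x₀ hx₀ u hu
    obtain ⟨h1, h2⟩ := hz' (hdisp u z hu huD hz t' ⟨htt', le_rfl⟩)
    have h3 := hC t' u y₀ _ y z τ ht' ht'i.le hu hy (hz.restrict htt') hτ (by linarith)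
      (by linarith)
    rw [norm_sub_rev] at h2
    have h4 : C * ‖y₀ - z t'‖ ≤ C * (2 * η) := mul_le_mul_of_nonneg_left h2 hC0
    have h5 : sys.payoff γ u z t' τ ≤ sys.payoff γ u z t (τ + (t' - t)) := by
      rw [payoff, payoff, show t + (τ + (t' - t)) = t' + τ by ring]
      exact mul_le_mul_of_nonneg_right (weight_mono hτ (by linarith))
        (gate_nonneg (norm_nonneg _) _)
    have h6 := H.payoff_le_lyapunov ht hu hz (show 0 ≤ τ + (t' - t) by linarith)
    linarith

theorem continuousOn_lyapunov (H : sys.IsISSWith β γ) (i : ℕ) :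
    ContinuousOn (Function.uncurry (sys.lyapunov γ))
      (Ico (sys.σ.time i) (sys.σ.time (i + 1)) ×ˢ sys.X) := by
  rintro ⟨t, x⟩ ⟨ht, hx⟩
  dsimp only at ht hx
  rw [ContinuousWithinAt, Metric.tendsto_nhds]
  intro ε hε
  obtain ⟨K, D, η, hη, hosc⟩ := H.exists_abs_lyapunov_sub_le i (R := ‖x‖ + 1) (by positivity)
    (half_pos hε)
  obtain ⟨r, htr, -, hr⟩ := exists_smallDisplacement_right H.complete H.estimate H.classKL
    H.classKInf.toClassK ht.1 ht.2 K D hη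
  obtain ⟨l, hlt, hl⟩ : ∃ l < t, ∀ q, sys.σ.time i ≤ q → l < q → q ≤ t → ∀ p ∈ Icc q t,
      sys.SmallDisplacement K D η q p := by
    -- At the left end of the piece no earlier times need to be considered.
    rcases ht.1.eq_or_lt with heq | hlt
    · refine ⟨t - 1, by linarith, fun q hiq _ hqt => ?_⟩
      have hqt : q = t := le_antisymm hqt (heq ▸ hiq)
      subst hqt
      exact fun p hp => hr _ _ le_rfl hp.1 (hp.2.trans_lt htr)
    · obtain ⟨l, -, hlt, hl⟩ := exists_smallDisplacement_left H.complete H.estimate H.classKL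
        H.classKInf.toClassK hlt ht.2.le K D hη
      exact ⟨l, hlt, fun q _ hlq _ p hp => hl _ _ hlq hp.1 hp.2⟩
  have hnhds : Ioo (max l (t - η)) (min r (t + η)) ×ˢ Metric.ball x (min η 1) ∈ 𝓝 (t, x) :=
    prod_mem_nhds (Ioo_mem_nhds (max_lt hlt (by linarith)) (lt_min htr (by linarith)))
      (Metric.ball_mem_nhds _ (lt_min hη one_pos))
  filter_upwards [mem_nhdsWithin_of_mem_nhds hnhds, self_mem_nhdsWithin]
  rintro ⟨t', y⟩ ⟨ht', hy⟩ ⟨hmem, hyX⟩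
  dsimp only at ht' hy hmem hyX
  obtain ⟨h1, h2⟩ := max_lt_iff.1 ht'.1
  obtain ⟨h3, h4⟩ := lt_min_iff.1 ht'.2
  rw [mem_ball_iff_norm] at hy
  obtain ⟨h5, h6⟩ := lt_min_iff.1 hy
  have h7 : ‖y‖ ≤ ‖x‖ + 1 := by linarith [norm_sub_norm_le y x]
  rw [Real.dist_eq]
  refine lt_of_le_of_lt ?_ (half_lt_self hε)
  rcases le_total t t' with h | h
  · rw [abs_sub_comm]
    exact hosc t t' ht.1 h hmem.2 h4.le x hx y hyX (by linarith) h7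
      (by rw [norm_sub_rev]; exact h5.le) fun q hq => hr _ _ le_rfl hq.1 (hq.2.trans_lt h3)
  · exact hosc t' t hmem.1 h ht.2 (by linarith) y hyX x hx h7 (by linarith) h5.le
      (hl t' hmem.1 h1 h)

/-- The Cauchy criterion avoids naming the limit: the oscillation bound compares any two points
shortly before the instant. -/
theorem exists_tendsto_lyapunov (H : sys.IsISSWith β γ) (i : ℕ) {x : EuclideanSpace ℝ (Fin n)}
    (hx : x ∈ sys.X) : ∃ l : ℝ, Tendsto (Function.uncurry (sys.lyapunov γ))
      (𝓝[Ico (sys.σ.time i) (sys.σ.time (i + 1)) ×ˢ sys.X] (sys.σ.time (i + 1), x)) (𝓝 l) := by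
  set b := sys.σ.time (i + 1) with hb
  have hib := sys.σ.time_lt_succ i
  have hne : (𝓝[Ico (sys.σ.time i) b ×ˢ sys.X] (b, x)).NeBot := by
    rw [← mem_closure_iff_nhdsWithin_neBot, closure_prod_eq, closure_Ico hib.ne]
    exact ⟨right_mem_Icc.2 hib.le, subset_closure hx⟩
  refine cauchy_iff_exists_le_nhds.1 (Metric.cauchy_iff.2 ⟨hne.map _, fun ε hε => ?_⟩)
  obtain ⟨K, D, η, hη, hosc⟩ := H.exists_abs_lyapunov_sub_le i (R := ‖x‖ + 1) (by positivity)
    (half_pos hε)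
  obtain ⟨l, -, hlb, hl⟩ := exists_smallDisplacement_left H.complete H.estimate H.classKL
    H.classKInf.toClassK hib le_rfl K D hη
  have hnhds : Ioi (max l (b - η)) ×ˢ Metric.ball x (min (η / 2) 1) ∈ 𝓝 (b, x) :=
    prod_mem_nhds (Ioi_mem_nhds (max_lt hlb (by linarith)))
      (Metric.ball_mem_nhds _ (lt_min (half_pos hη) one_pos))
  refine ⟨_, image_mem_map (inter_mem_nhdsWithin _ hnhds), ?_⟩
  have key : ∀ t y t' y', (t, y) ∈ (Ico (sys.σ.time i) b ×ˢ sys.X) ∩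
      (Ioi (max l (b - η)) ×ˢ Metric.ball x (min (η / 2) 1)) →
      (t', y') ∈ (Ico (sys.σ.time i) b ×ˢ sys.X) ∩
      (Ioi (max l (b - η)) ×ˢ Metric.ball x (min (η / 2) 1)) → t ≤ t' →
      |sys.lyapunov γ t y - sys.lyapunov γ t' y'| ≤ ε / 2 := by
    rintro t y t' y' ⟨⟨h1, h2⟩, h3, h4⟩ ⟨⟨h1', h2'⟩, h3', h4'⟩ htt'
    dsimp only at h1 h2 h3 h4 h1' h2' h3' h4'
    obtain ⟨h5, h6⟩ := max_lt_iff.1 (mem_Ioi.1 h3)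
    rw [mem_ball_iff_norm] at h4 h4'
    obtain ⟨h7, h8⟩ := lt_min_iff.1 h4
    obtain ⟨h7', h8'⟩ := lt_min_iff.1 h4'
    refine hosc t t' h1.1 htt' h1'.2 (by linarith [h1'.2]) y h2 y' h2'
      (by linarith [norm_sub_norm_le y x]) (by linarith [norm_sub_norm_le y' x]) ?_
      fun q hq => hl _ _ h5 hq.1 (hq.2.trans h1'.2.le)
    have := norm_sub_le_norm_sub_add_norm_sub y x y'
    rw [norm_sub_rev x y'] at this
    linarith
  rintro _ ⟨⟨t, y⟩, hp, rfl⟩ _ ⟨⟨t', y'⟩, hp', rfl⟩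
  rw [Real.dist_eq]
  refine lt_of_le_of_lt ?_ (half_lt_self hε)
  rcases le_total t t' with h | h
  · exact key _ _ _ _ hp hp' h
  · rw [abs_sub_comm]
    exact key _ _ _ _ hp' hp h

theorem isSwitchedPiecewiseContinuous (H : sys.IsISSWith β γ) :
    sys.IsSwitchedPiecewiseContinuous (sys.lyapunov γ) where
  nonneg t ht x _ := (norm_nonneg x).trans (H.norm_le_lyapunov ht x)
  modes := by
    refine ⟨fun _ => sys.lyapunov γ, fun p => ?_, fun _ _ _ _ => rfl⟩
    rintro ⟨t, x⟩ ⟨⟨ht, hp⟩, hx⟩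
    dsimp only at ht hp hx
    obtain ⟨i, hi⟩ := sys.σ.exists_mem_Ico ht
    refine (H.continuousOn_lyapunov i (t, x) ⟨hi, hx⟩).mono_of_mem_nhdsWithin ?_
    have hmode : sys.σ.mode i = p := (sys.σ.toFun_eq i t hi).symm.trans hp
    -- At a switching instant the preceding piece has a different mode, so near `t` the active set
    -- stays inside one piece.
    obtain ⟨l, hlt, hl⟩ : ∃ l < t, ∀ q, sys.t₀ ≤ q → l < q → q < t → sys.σ.toFun q = p →
        sys.σ.time i ≤ q := by
      rcases hi.1.lt_or_eq with hlt | heq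
      · exact ⟨_, hlt, fun q _ hq _ _ => hq.le⟩
      rcases i with _ | i
      · exact ⟨t - 1, by linarith, fun q hq _ _ _ => sys.σ.time_zero.le.trans hq⟩
      · refine ⟨sys.σ.time i, heq ▸ sys.σ.time_lt_succ i, fun q _ hiq hqt hqp => ?_⟩
        rw [sys.σ.toFun_eq i q ⟨hiq.le, heq ▸ hqt⟩, ← hmode] at hqp
        exact absurd hqp (sys.σ.mode_ne i)
    refine mem_of_superset (inter_mem_nhdsWithin _
      (prod_mem_nhds (Ioo_mem_nhds hlt hi.2) univ_mem)) ?_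
    rintro ⟨q, y⟩ ⟨⟨⟨hq, hqp⟩, hy⟩, hq', -⟩
    refine ⟨⟨?_, hq'.2⟩, hy⟩
    rcases lt_or_ge q t with h | h
    · exact hl q hq hq'.1 h hqp
    · exact hi.1.trans h
  leftLim i x hx := H.exists_tendsto_lyapunov i hx

/-- The jump maps satisfy the estimate of solutions for vanishing elapsed time. -/
theorem norm_jump_le (H : sys.IsISSWith β γ) (i : ℕ) {x : EuclideanSpace ℝ (Fin n)}
    (hx : x ∈ sys.X) {u : ℝ → EuclideanSpace ℝ (Fin m)} (hu : sys.IsInput u) :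
    ‖sys.jump i u x‖ ≤ β ‖x‖ 0 + γ (sys.inputNorm u) := by
  set b := sys.σ.time (i + 1) with hb
  have hib := sys.σ.time_lt_succ i
  set K := β ‖x‖ 0 + γ (sys.inputNorm u) with hK
  obtain ⟨L, hL0, hL⟩ := sys.exists_jumpLipschitz K (sys.inputNorm u)
  -- A solution started at `x` shortly before the instant reaches the jump within `η` of `x`, and
  -- obeys the ISS estimate after it. The Lipschitz jump map transfers the bound to `x`.
  have key : ∀ η > 0, ‖sys.jump i u x‖ ≤ K + L * η := by
    intro η hη
    obtain ⟨l, hil, hlb, hl⟩ := exists_smallDisplacement_left H.complete H.estimate H.classKL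
      H.classKInf.toClassK hib le_rfl K (sys.inputNorm u) hη
    obtain ⟨t, hlt, htb⟩ := exists_between hlb
    have hit : sys.σ.time i ≤ t := hil.trans hlt.le
    have ht : sys.t₀ ≤ t := (sys.σ.t₀_le_time i).trans hit
    obtain ⟨z, hz⟩ := (H.complete t ht).1 x hx u hu
    have hzK : ∀ q, t ≤ q → ‖z q‖ ≤ K := fun q hq =>
      hz.norm_le_of_le H.complete H.estimate H.classKL H.classKInf.toClassK ht hu le_rfl le_rfl hq
    have hlim := hz.tendsto_leftLim htb
    have hyK : ‖Function.leftLim z b‖ ≤ K := by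
      refine le_of_tendsto hlim.norm ?_
      filter_upwards [Ico_mem_nhdsLT htb] with q hq using hzK q hq.1
    have hdisp := hl t b hlt htb.le le_rfl u hu le_rfl _ (hz.isFlow_update le_rfl hit htb) ?_
    · rw [Function.update_self, Function.update_of_ne htb.ne, hz.init] at hdisp
      have hxK : ‖x‖ ≤ K := by
        have := hzK t le_rfl
        rwa [hz.init] at this
      have h1 := hL (sys.σ.mode i) b (sys.σ.t₀_le_time _) _ (hu.leftLim_mem i)
        (hu.norm_leftLim_le i) x hx _ (hz.leftLim_mem htb) hxK hyK
      have h2 : ‖sys.jump i u x - z b‖ ≤ L * ‖x - Function.leftLim z b‖ := by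
        rw [hz.jump i htb]
        exact h1
      rw [norm_sub_rev x] at h2
      have h3 := norm_sub_norm_le (sys.jump i u x) (z b)
      have h4 := mul_le_mul_of_nonneg_left hdisp hL0
      linarith [hzK b htb.le]
    · intro q hq
      rcases hq.2.eq_or_lt with rfl | hqb
      · rwa [Function.update_self]
      · rw [Function.update_of_ne hqb.ne]
        exact hzK q hq.1
  refine le_of_forall_pos_le_add fun ε hε => ?_
  refine (key (ε / (L + 1)) (by positivity)).trans ?_
  have : L * (ε / (L + 1)) ≤ ε := by
    rw [mul_div_assoc', div_le_iff₀ (by positivity)]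
    nlinarith
  linarith

end IsISSWith

theorem IsSwitchedPiecewiseContinuous.tendsto_leftVal
    {V : ℝ → EuclideanSpace ℝ (Fin n) → ℝ} (hV : sys.IsSwitchedPiecewiseContinuous V) (i : ℕ)
    {x : EuclideanSpace ℝ (Fin n)} (hx : x ∈ sys.X) :
    Tendsto (Function.uncurry V)
      (𝓝[Ico (sys.σ.time i) (sys.σ.time (i + 1)) ×ˢ sys.X] (sys.σ.time (i + 1), x))
      (𝓝 (sys.leftVal V i x)) := by
  obtain ⟨l, hl⟩ := hV.leftLim i x hx
  have h1 : Tendsto (fun t => V t x) (𝓝[<] sys.σ.time (i + 1)) (𝓝 l) := by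
    refine hl.comp (f := fun t => (t, x)) (tendsto_nhdsWithin_iff.2 ⟨?_, ?_⟩)
    · exact (Continuous.prodMk_left x).continuousAt.tendsto.mono_left nhdsWithin_le_nhds
    · filter_upwards [Ico_mem_nhdsLT (sys.σ.time_lt_succ i)] with t ht using ⟨ht, hx⟩
  rwa [leftVal, leftLim_eq_of_tendsto h1]

/-- The values of `V` along a curve with a left limit at a switching instant tend to the left
value. -/
theorem IsSwitchedPiecewiseContinuous.tendsto_comp_leftVal
    {V : ℝ → EuclideanSpace ℝ (Fin n) → ℝ} (hV : sys.IsSwitchedPiecewiseContinuous V) {i : ℕ}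
    {s : ℝ} (hs : s < sys.σ.time (i + 1)) {x : EuclideanSpace ℝ (Fin n)} (hx : x ∈ sys.X)
    {z : ℝ → EuclideanSpace ℝ (Fin n)} (hz : ∀ t, s ≤ t → z t ∈ sys.X)
    (hlim : Tendsto z (𝓝[<] sys.σ.time (i + 1)) (𝓝 x)) :
    Tendsto (fun t => V t (z t)) (𝓝[<] sys.σ.time (i + 1)) (𝓝 (sys.leftVal V i x)) := by
  refine (hV.tendsto_leftVal i hx).comp (f := fun t => (t, z t)) (tendsto_nhdsWithin_iff.2 ⟨?_, ?_⟩)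
  · exact (tendsto_id.mono_left nhdsWithin_le_nhds).prodMk_nhds hlim
  · filter_upwards [Ico_mem_nhdsLT (sys.σ.time_lt_succ i), Ico_mem_nhdsLT hs] with t ht hst
    exact ⟨ht, hz t hst.1⟩

end ImpulsiveSwitchedSystem

/-! ### Closure properties of comparison functions and conclusion. -/

theorem ClassK.add {γ δ : ℝ → ℝ} (hγ : ClassK γ) (hδ : ClassK δ) : ClassK fun r => γ r + δ r where
  continuousOn := hγ.continuousOn.add hδ.continuousOn
  strictMonoOn := hγ.strictMonoOn.add hδ.strictMonoOn
  map_zero := by rw [hγ.map_zero, hδ.map_zero, add_zero]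

theorem ClassK.const_mul {γ : ℝ → ℝ} (hγ : ClassK γ) {c : ℝ} (hc : 0 < c) :
    ClassK fun r => c * γ r where
  continuousOn := continuousOn_const.mul hγ.continuousOn
  strictMonoOn _ hr _ hs hrs := mul_lt_mul_of_pos_left (hγ.strictMonoOn hr hs hrs) hc
  map_zero := by rw [hγ.map_zero, mul_zero]

theorem ClassK.comp {γ δ : ℝ → ℝ} (hγ : ClassK γ) (hδ : ClassK δ) : ClassK fun r => γ (δ r) where
  continuousOn := hγ.continuousOn.comp hδ.continuousOn fun _ hr => hδ.nonneg hr
  strictMonoOn _ hr _ hs hrs :=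
    hγ.strictMonoOn (hδ.nonneg hr) (hδ.nonneg hs) (hδ.strictMonoOn hr hs hrs)
  map_zero := by rw [hδ.map_zero, hγ.map_zero]

theorem classKInf_id : ClassKInf fun r => r where
  continuousOn := continuousOn_id
  strictMonoOn := strictMono_id.strictMonoOn _
  map_zero := rfl
  tendsto_atTop := tendsto_id

theorem ClassKInf.add_classK {γ δ : ℝ → ℝ} (hγ : ClassKInf γ) (hδ : ClassK δ) :
    ClassKInf fun r => γ r + δ r where
  toClassK := hγ.toClassK.add hδ
  tendsto_atTop := by
    refine tendsto_atTop_mono' _ ?_ hγ.tendsto_atTop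
    filter_upwards [eventually_ge_atTop 0] with r hr
    linarith [hδ.nonneg hr]

theorem ClassKInf.const_mul {γ : ℝ → ℝ} (hγ : ClassKInf γ) {c : ℝ} (hc : 0 < c) :
    ClassKInf fun r => c * γ r where
  toClassK := hγ.toClassK.const_mul hc
  tendsto_atTop := hγ.tendsto_atTop.const_mul_atTop hc

namespace ImpulsiveSwitchedSystem

theorem IsISSWith.isDecreasingISSLyapunov {n m : ℕ} {M : Type*}
    {sys : ImpulsiveSwitchedSystem n m M} {β : ℝ → ℝ → ℝ} {γ : ℝ → ℝ} (H : sys.IsISSWith β γ) :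
    sys.IsDecreasingISSLyapunov (sys.lyapunov γ) := by
  obtain ⟨φ, hφP, hφ⟩ := H.classKL.exists_rate
  have hφ0 : ∀ s, 0 ≤ s → 0 ≤ φ s := fun s hs => by
    rcases hs.eq_or_lt with rfl | hs
    · exact hφP.map_zero.ge
    · exact (hφP.pos s hs).le
  have hneg : ClassP fun s => - -φ s := by simpa only [neg_neg] using hφP
  have hpc := H.isSwitchedPiecewiseContinuous
  have hβ0 := H.classKL.classK 0 le_rfl
  have hα₂ : ClassKInf fun r => r + 4 * β r 0 :=
    classKInf_id.add_classK (hβ0.const_mul (by norm_num))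
  have hχ : ClassKInf fun r => 16 * γ r := H.classKInf.const_mul (by norm_num)
  refine ⟨fun _ s => -φ s, fun _ s => s, ⟨hpc, ⟨fun r => r, fun r => r + 4 * β r 0, classKInf_id,
    hα₂, fun t ht x _ => ⟨H.norm_le_lyapunov ht x, H.lyapunov_le_bound ht x⟩⟩,
    fun _ => ⟨continuousOn_id, rfl, fun _ hr => hr⟩, fun _ => Or.inr hneg,
    ⟨φ, φ, hφP, hφP, fun _ s hs => by rw [abs_neg, abs_of_nonneg (hφ0 s hs)]; simp⟩,
    fun r => 16 * γ r, hχ, ?_, ?_⟩, fun _ => ⟨hneg, fun _ _ => le_rfl⟩⟩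
  · intro s hs x₀ hx₀ u hu x hx
    refine ⟨fun t hst _ hW => H.upperDini_lyapunov_le hφP hφ hs hu hx hst hW, fun i hi hW => ?_⟩
    rw [← hx.jump i hi]
    -- The bound by `max W (8 * γ)` passes to the limit `t ↑ time (i + 1)`, where `W ≥ 16 * γ` makes
    -- the second entry irrelevant.
    have h1 := (hpc.tendsto_comp_leftVal hi (hx.leftLim_mem hi) hx.mem
      (hx.tendsto_leftLim hi)).max (tendsto_const_nhds (x := 8 * γ (sys.inputNorm u)))
    have hu0 := H.gain_nonneg u
    rw [max_eq_left (by linarith)] at h1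
    refine ge_of_tendsto h1 ?_
    filter_upwards [Ico_mem_nhdsLT hi] with t ht
    exact H.lyapunov_le_max hs hu hx ht.1 ht.2.le
  -- The upper bound `r + 4 * β r 0` of `W` at the jump estimate for `‖x‖ ≤ W(tᵢ⁻, x) < 16 * γ d`.
  · refine ⟨fun d => (β (16 * γ d) 0 + γ d) + 4 * β (β (16 * γ d) 0 + γ d) 0, ?_, ?_⟩
    · exact hα₂.toClassK.comp ((hβ0.comp hχ.toClassK).add H.classKInf.toClassK)
    · intro x hx u hu i hlt
      have h1 : ‖x‖ ≤ sys.leftVal (sys.lyapunov γ) i x := by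
        refine ge_of_tendsto (hpc.tendsto_comp_leftVal (sys.σ.time_lt_succ i) hx
          (fun _ _ => hx) tendsto_const_nhds) ?_
        filter_upwards [Ico_mem_nhdsLT (sys.σ.time_lt_succ i)] with t ht
        exact H.norm_le_lyapunov ((sys.σ.t₀_le_time i).trans ht.1) x
      have h2 := (H.norm_jump_le i hx hu).trans (add_le_add_left
        (hβ0.mono (norm_nonneg x) (h1.trans hlt.le)) _)
      exact (H.lyapunov_le_bound (sys.σ.t₀_le_time _) _).trans
        (hα₂.mono (norm_nonneg _) h2)

end ImpulsiveSwitchedSystem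
end ISS
end

theorem mainTheorem2 {n m : ℕ} {M : Type*} (sys : ISS.ImpulsiveSwitchedSystem n m M)
    (hcomplete : sys.IsRobustlyForwardComplete) (hISS : sys.IsISS) :
    ∃ W : ℝ → EuclideanSpace ℝ (Fin n) → ℝ, sys.IsDecreasingISSLyapunov W := by
  obtain ⟨β, γ, hβ, hγ, hest⟩ := hISS
  exact ⟨_, ISS.ImpulsiveSwitchedSystem.IsISSWith.isDecreasingISSLyapunov
    (β := β) (γ := γ) ⟨hcomplete, hβ, hγ, hest⟩⟩
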